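/- **Proposition 2.6.** Let $M=G/K$ be a Riemannian symmetric space of compact type: $G$ is a (finite-dimensional, real) Lie group, $\sigma$ is a smooth involutive automorphism of $G$, $K$ is a subgroup of $G$ lying between the fixed group $G^\sigma$ and its identity component, and the Killing form $\varkappa$ of the Lie algebra $\mathfrak g$ of $G$ is negative definite. Let $\mathfrak g=\mathfrak k\oplus\mathfrak m$ be the decomposition into the $(+1)$- and $(-1)$-eigenspaces of $d\sigma_1$, and equip $\mathfrak g$ with the inner product $\langle\cdot,\cdot\rangle=-c\,\varkappa$ for some constant $c>0$; orthogonality refers to it. A linear subspace $\mathfrak m'\subset\mathfrak m$ is a *Lie triple system* if $[[\mathfrak m',\mathfrak m'],\mathfrak m']\subset\mathfrak m'$ ($\mathfrak m$ itself is one). A subspace $\mathfrak b\subset\mathfrak m'$ is *flat* if $[\mathfrak b,\mathfrak b]=\{0\}$; the *rank* $\mathrm{rk}(\mathfrak m')$ is the maximal dimension of a flat subspace of $\mathfrak m'$, and a *Cartan subalgebra* of $\mathfrak m'$ is a flat subspace of $\mathfrak m'$ of dimension $\mathrm{rk}(\mathfrak m')$. For a Cartan subalgebra $\mathfrak a'$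 of $\mathfrak m'$ and $\alpha\in(\mathfrak a')^*$ put $\mathfrak m'_\alpha=\{X\in\mathfrak m' \mid \forall Z\in\mathfrak a':\ \mathrm{ad}(Z)^2X=-\alpha(Z)^2X\}$, and let $\Delta(\mathfrak m',\mathfrak a')=\{\alpha\in(\mathfrak a')^*\setminus\{0\}\mid \mathfrak m'_\alpha\neq\{0\}\}$ be the root system. The *Weyl group* $W(\mathfrak m',\mathfrak a')$ is the group of linear transformations of $\mathfrak a'$ generated by the orthogonal reflections of $\mathfrak a'$ in the hyperplanes $\alpha^{-1}(\{0\})$, $\alpha\in\Delta(\mathfrak m',\mathfrak a')$; it acts on $(\mathfrak a')^*$ by $(B,\alpha)\mapsto\alpha\circ B^{-1}$. The same notations are used for $\mathfrak m$. Let $\mathfrak m'\subset\mathfrak m$ be a Lie triple system and let $\mathfrak a$ be a Cartan subalgebra of $\mathfrak m$ such that $\mathfrak a':=\mathfrak a\cap\mathfrak m'$ is a Cartan subalgebra of $\mathfrak m'$. Then: (a) $W(\mathfrak m',\mathfrak a')\subset\{\,(P_{\mathfrak a'}\circ B)|_{\mathfrak a'} \mid B\in W(\mathfrak m,\mathfrak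 a)\,\}$, where $P_{\mathfrak a'}:\mathfrak a\to\mathfrak a$ is the orthogonal projection onto $\mathfrak a'$. In particular, if $\mathrm{rk}(\mathfrak m')=\mathrm{rk}(\mathfrak m)$, then $\mathfrak a'=\mathfrak a$ and $W(\mathfrak m',\mathfrak a)\subset W(\mathfrak m,\mathfrak a)$. (b) Let $K'$ be the connected Lie subgroup of $G$ with Lie algebra $[\mathfrak m',\mathfrak m']$, that is, the subgroup generated by $\mathrm{Exp}([\mathfrak m',\mathfrak m'])$. Then $K'\subset K$, and for every $B\in W(\mathfrak m',\mathfrak a')$ there exists $g\in K'$ with $B=\mathrm{Ad}(g)|_{\mathfrak a'}$. (c) $W(\mathfrak m',\mathfrak a')$ leaves $\Delta(\mathfrak m',\mathfrak a')$ invariant: $\{\alpha\circ B^{-1}\mid\alpha\in\Delta(\mathfrak m',\mathfrak a')\}=\Delta(\mathfrak m',\mathfrak a')$ for every $B\in W(\mathfrak m',\mathfrak a')$. -/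

import Mathlib

open scoped Manifold ContDiff

noncomputable section

/-- Over `ℝ` one has `minSmoothness ℝ 3 = 3`; this makes Mathlib's Lie algebra structure on
`GroupLieAlgebra I G` available for smooth real Lie groups. -/
instance minSmoothness_real_three_leInfty : ENat.LEInfty (minSmoothness ℝ 3) :=
  ⟨by
    rw [minSmoothness_of_isRCLikeNormedField]
    exact ENat.LEInfty.out⟩

namespace LieTriple

/-! ### Flat subspaces, roots and Weyl groups inside a real Lie algebra -/

section Algebra

variable {𝔤 : Type*} [LieRing 𝔤] [LieAlgebra ℝ 𝔤]

/-- The bilinear form `-c · ϰ`, where `ϰ` is the Killing form of `𝔤`. It is an inner product when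
`ϰ` is negative definite and `c > 0`. -/
def metric (𝔤 : Type*) [LieRing 𝔤] [LieAlgebra ℝ 𝔤] (c : ℝ) : LinearMap.BilinForm ℝ 𝔤 :=
  (-c) • killingForm ℝ 𝔤

/-- The Killing form of `𝔤` is negative definite. -/
def KillingNegDef (𝔤 : Type*) [LieRing 𝔤] [LieAlgebra ℝ 𝔤] : Prop :=
  ∀ X : 𝔤, X ≠ 0 → killingForm ℝ 𝔤 X X < 0

/-- `m` is a Lie triple system: `[[m, m], m] ⊆ m`. -/
def IsLieTripleSystem (m : Submodule ℝ 𝔤) : Prop :=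
  ∀ X ∈ m, ∀ Y ∈ m, ∀ Z ∈ m, ⁅⁅X, Y⁆, Z⁆ ∈ m

/-- The linear subspace `[m, m]` spanned by the brackets of elements of `m`. -/
def derived (m : Submodule ℝ 𝔤) : Submodule ℝ 𝔤 :=
  Submodule.span ℝ {T | ∃ X ∈ m, ∃ Y ∈ m, ⁅X, Y⁆ = T}

/-- A subspace `a` is flat if `[a, a] = 0`. -/
def IsFlat (a : Submodule ℝ 𝔤) : Prop :=
  ∀ X ∈ a, ∀ Y ∈ a, ⁅X, Y⁆ = 0

/-- The rank of `m`: the maximal dimension of a flat subspace of `m`. -/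
def rank (m : Submodule ℝ 𝔤) : ℕ :=
  sSup {d | ∃ a : Submodule ℝ 𝔤, a ≤ m ∧ IsFlat a ∧ Module.finrank ℝ a = d}

/-- `a` is a Cartan subalgebra of `m`: a flat subspace of `m` of dimension `rank m`. -/
def IsCartan (m a : Submodule ℝ 𝔤) : Prop :=
  a ≤ m ∧ IsFlat a ∧ Module.finrank ℝ a = rank m

/-- `m_α = {X ∈ m | ∀ Z ∈ a, ad(Z)² X = -α(Z)² X}`. -/
def rootSpace (m a : Submodule ℝ 𝔤) (α : Module.Dual ℝ a) : Submodule ℝ 𝔤 where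
  carrier := {X | X ∈ m ∧ ∀ Z : a, ⁅(Z : 𝔤), ⁅(Z : 𝔤), X⁆⁆ = -(α Z) ^ 2 • X}
  zero_mem' := ⟨m.zero_mem, fun Z => by simp⟩
  add_mem' := fun {X Y} hX hY => ⟨m.add_mem hX.1 hY.1, fun Z => by
    rw [lie_add, lie_add, hX.2 Z, hY.2 Z, smul_add]⟩
  smul_mem' := fun r X hX => ⟨m.smul_mem r hX.1, fun Z => by
    rw [lie_smul, lie_smul, hX.2 Z, smul_comm]⟩

/-- The root system `Δ(m, a)`: the nonzero linear forms on `a` with nonzero root space. -/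
def roots (m a : Submodule ℝ 𝔤) : Set (Module.Dual ℝ a) :=
  {α | α ≠ 0 ∧ rootSpace m a α ≠ ⊥}

/-- `R : a → a` is the reflection in the hyperplane `α⁻¹(0)` that is orthogonal with respect
to `-c · ϰ`: it fixes the hyperplane pointwise and is `-1` on its orthogonal complement in `a`. -/
def IsOrthogonalReflection (c : ℝ) (a : Submodule ℝ 𝔤) (α : Module.Dual ℝ a)
    (R : a ≃ₗ[ℝ] a) : Prop :=
  (∀ Z : a, α Z = 0 → R Z = Z) ∧
  (∀ Z : a, (∀ Y : a, α Y = 0 → metric 𝔤 c (Y : 𝔤) (Z : 𝔤) = 0) → R Z = -Z)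

/-- The Weyl group `W(m, a)`: the group of linear transformations of `a` generated by the
orthogonal reflections in the hyperplanes `α⁻¹(0)`, `α ∈ Δ(m, a)`. -/
def weylGroup (c : ℝ) (m a : Submodule ℝ 𝔤) : Subgroup (a ≃ₗ[ℝ] a) :=
  Subgroup.closure {R | ∃ α ∈ roots m a, IsOrthogonalReflection c a α R}

/-- `P : a → a` is the orthogonal projection of `a` onto its subspace `a'`, with respect
to `-c · ϰ`. -/
def IsOrthogonalProjection (c : ℝ) (a a' : Submodule ℝ 𝔤) (P : a →ₗ[ℝ] a) : Prop :=
  (∀ Z : a, (P Z : 𝔤) ∈ a') ∧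
  (∀ Z : a, ∀ Y ∈ a', metric 𝔤 c Y ((Z : 𝔤) - (P Z : 𝔤)) = 0)

end Algebra

/-! ### Lie groups and symmetric pairs -/

section Group

variable {E : Type*} [NormedAddCommGroup E] [NormedSpace ℝ E]
  {G : Type*} [TopologicalSpace G] [ChartedSpace E G] [Group G]

/-- The adjoint action `Ad(g) : 𝔤 → 𝔤`, the derivative at `1` of `x ↦ g x g⁻¹`. (This map sends
`1` to `g * 1 * g⁻¹ = 1`, so its derivative takes values in the tangent space at `1`.) -/
def Ad (g : G) : GroupLieAlgebra 𝓘(ℝ, E) G →L[ℝ] GroupLieAlgebra 𝓘(ℝ, E) G :=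
  mfderiv 𝓘(ℝ, E) 𝓘(ℝ, E) (fun x : G => g * x * g⁻¹) 1

/-- The derivative at `1` of a group endomorphism `σ` of `G` (note `σ 1 = 1`). -/
def derivOne (σ : G →* G) : GroupLieAlgebra 𝓘(ℝ, E) G →L[ℝ] GroupLieAlgebra 𝓘(ℝ, E) G :=
  mfderiv 𝓘(ℝ, E) 𝓘(ℝ, E) (fun x : G => σ x) 1

/-- `(G, K, σ)` is a symmetric pair: `σ` is a smooth involutive automorphism of `G`, and `K` lies
between the fixed group of `σ` and the identity component of that fixed group. Then
`M = G/K` is a symmetric space (and `K` is open in the closed subgroup `G^σ`, hence closed). -/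
structure IsSymmetricPair (E : Type*) [NormedAddCommGroup E] [NormedSpace ℝ E]
    {G : Type*} [TopologicalSpace G] [ChartedSpace E G] [Group G]
    (σ : G →* G) (K : Subgroup G) : Prop where
  smooth : ContMDiff 𝓘(ℝ, E) 𝓘(ℝ, E) ∞ (fun x : G => σ x)
  involutive : ∀ g : G, σ (σ g) = g
  le_fixed : ∀ g ∈ K, σ g = g
  identityComponent_le : ∀ g ∈ connectedComponentIn {x : G | σ x = x} 1, g ∈ K

/-- The subspace `𝔪` in the decomposition `𝔤 = 𝔨 ⊕ 𝔪` induced by the involution `σ`: the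
`(-1)`-eigenspace of the derivative of `σ` at `1`. -/
def tangentPart (E : Type*) [NormedAddCommGroup E] [NormedSpace ℝ E]
    {G : Type*} [TopologicalSpace G] [ChartedSpace E G] [Group G]
    (σ : G →* G) : Submodule ℝ (GroupLieAlgebra 𝓘(ℝ, E) G) :=
  LinearMap.ker (((derivOne (E := E) σ) + ContinuousLinearMap.id ℝ (GroupLieAlgebra 𝓘(ℝ, E) G) :
    GroupLieAlgebra 𝓘(ℝ, E) G →L[ℝ] GroupLieAlgebra 𝓘(ℝ, E) G) :
    GroupLieAlgebra 𝓘(ℝ, E) G →ₗ[ℝ] GroupLieAlgebra 𝓘(ℝ, E) G)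

/-- `g = Exp(X)`, where `Exp` is the exponential map of `G`: `g` is the value at time `1` of the
integral curve of the left-invariant vector field of `X` that starts at `1`. -/
def IsExp (X : GroupLieAlgebra 𝓘(ℝ, E) G) (g : G) : Prop :=
  ∃ γ : ℝ → G, γ 0 = 1 ∧ IsMIntegralCurve (I := 𝓘(ℝ, E)) γ (mulInvariantVectorField X) ∧ γ 1 = g

/-- The connected Lie subgroup of `G` with Lie algebra `𝔥` (for `𝔥` a Lie subalgebra): the
subgroup generated by `Exp(𝔥)`. -/
def connectedLieSubgroup (𝔥 : Submodule ℝ (GroupLieAlgebra 𝓘(ℝ, E) G)) : Subgroup G :=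
  Subgroup.closure {g | ∃ X ∈ 𝔥, IsExp X g}

end Group

end LieTriple

end

open scoped Topology

noncomputable section

/-! ### Half-turns by exponentials of operators. -/

namespace LieTriple

/-! Each root `α` of a Lie triple system yields a root vector `X`, a vector `Y` in the derived space
and an axis `A` in the Cartan subalgebra with `[Y, A] = α(A) X` and `[Y, X] = -A`
(`exists_rootTriple`). Thus `ad Y` rotates the plane of `A` and `X` and kills `ker α`, and a
half-turn along `Y` induces the reflection in `α`. In the group this gives (b): `Y` is fixed by the
involution `θ = dσ`, and the half-turn is `Ad` of a point on the one-parameter subgroup of `Y`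
(`exists_Ad_eq_reflection`). This needs the derivative of `Ad` along such a subgroup, computed from
the second derivative of the product in a chart. The same half-turn, taken as an operator on `𝔤`,
carries root spaces to root spaces, which is (c).

For (a) more is shown: every element of `W(m', a')` is the restriction of an element of `W(m, a)`,
so the projection does nothing. On the vector space `𝔤` put the bracket of the dual symmetric Lie
algebra (`dualAd`). There `a` acts diagonalizably over the reals, and its nonzero weights are
exactly the roots. Call two elements conjugate if they act by similar operators in every
finite-dimensional representation of the dual bracket (`IsRepConj`). Points in one Weyl orbit of
`a'` are conjugate by the half-turns above, and this notion no longer mentions `m'`.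

Conversely, conjugate `U, V` in `a` lie in one `W(m, a)`-orbit (`exists_weylGroup_apply_eq`).
Replace `V` by the point of its orbit maximizing the inner product with `U`; then no weight is
positive on `U` and negative on `V`. Extremal vectors in spaces of multilinear forms then bound
partial sums of the weights of `U` by those of `V`, and equality of the traces and of the traces of
squares forces the weights to agree (`weight_eq_of_isRepConj`). Since weights separate points of
`a`, the two elements coincide.

So each `Z` in `a'` is matched with its image by some element of `W(m, a)`, a priori depending on
`Z`. The group is finite, and a real vector space is not a finite union of proper subspaces, so one
element serves for all `Z` (`exists_weylGroup_extension`). -/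

open NormedSpace in
/-- If `y` rotates the plane spanned by `a` and `x`, conjugation by a suitable exponential of `y`
maps `a` to `-a`. -/
theorem exp_conj_eq_neg {𝔸 : Type*} [NormedRing 𝔸] [NormedAlgebra ℝ 𝔸] [CompleteSpace 𝔸]
    [NormedAlgebra ℚ 𝔸] {y a x : 𝔸} {p q : ℝ} (hp : 0 < p) (hq : 0 < q)
    (h1 : y * a - a * y = p • x) (h2 : y * x - x * y = -(q • a)) :
    ∃ t : ℝ, exp (t • y) * a = -(a * exp (t • y)) := by
  obtain ⟨r, hr, hr2⟩ : ∃ r : ℝ, 0 < r ∧ r * r = p * q :=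
    ⟨√(p * q), by positivity, Real.mul_self_sqrt (by positivity)⟩
  -- `M` solves `M' = [y, M]` with `M 0 = a`, so undoing the conjugation by `exp (t y)` leaves a
  -- constant. At `t = π / r` one has `M = -a`.
  let M : ℝ → 𝔸 := fun t => Real.cos (r * t) • a + (p / r * Real.sin (r * t)) • x
  let f : ℝ → 𝔸 := fun t => exp (t • (-y)) * M t * exp (t • y)
  have hM : ∀ t, HasDerivAt M (y * M t - M t * y) t := by
    intro t
    have hl : HasDerivAt (fun t : ℝ => r * t) r t := by
      simpa using (hasDerivAt_id t).const_mul r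
    have h := (hl.cos.smul_const a).add ((hl.sin.const_mul (p / r)).smul_const x)
    convert! h using 1
    have e1 : y * M t - M t * y = Real.cos (r * t) • (y * a - a * y)
        + (p / r * Real.sin (r * t)) • (y * x - x * y) := by
      simp only [M, mul_add, add_mul, mul_smul_comm, smul_mul_assoc, smul_sub]
      abel
    rw [e1, h1, h2, smul_smul, smul_neg, smul_smul, ← sub_eq_add_neg, add_comm, sub_eq_add_neg,
      ← neg_smul]
    congr 2
    · field_simp
    · field_simp
      linear_combination (Real.sin (r * t)) * hr2
  have hf : ∀ t, HasDerivAt f 0 t := by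
    intro t
    have hE := hasDerivAt_exp_smul_const y t
    have hE' := hasDerivAt_exp_smul_const (-y) t
    have h := (hE'.mul (hM t)).mul hE
    convert! h using 1
    have hc : exp (t • y) * y = y * exp (t • y) :=
      (((Commute.refl y).smul_left t).exp_left).eq
    rw [hc]
    change 0 = _ + exp (t • -y) * M t * (y * exp (t • y))
    noncomm_ring
  have hconst : ∀ t, f t = f 0 := fun t =>
    is_const_of_deriv_eq_zero (fun s => (hf s).differentiableAt) (fun s => (hf s).deriv) t 0
  refine ⟨Real.pi / r, ?_⟩
  have h := hconst (Real.pi / r)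
  have hpi : r * (Real.pi / r) = Real.pi := by field_simp
  simp only [f, M, hpi, mul_zero, Real.cos_pi, Real.sin_pi, Real.cos_zero, Real.sin_zero,
    zero_smul, add_zero, one_smul, exp_zero, one_mul, mul_one, neg_smul] at h
  set t₀ := Real.pi / r
  have hinv : exp (t₀ • y) * exp (t₀ • (-y)) = 1 := by
    have : t₀ • (-y) = -(t₀ • y) := by simp
    rw [this, ← exp_add_of_commute ((Commute.refl (t₀ • y)).neg_right)]
    simp
  calc exp (t₀ • y) * a = exp (t₀ • y) * (exp (t₀ • (-y)) * -a * exp (t₀ • y)) := by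
        rw [h]
    _ = exp (t₀ • y) * exp (t₀ • (-y)) * -a * exp (t₀ • y) := by noncomm_ring
    _ = -(a * exp (t₀ • y)) := by rw [hinv]; noncomm_ring

/-- An algebraic form of `exp_conj_eq_neg` for operators on a finite-dimensional vector space. -/
theorem exists_equiv_conj_eq_neg {V : Type*} [AddCommGroup V] [Module ℝ V] [FiniteDimensional ℝ V]
    {y a x : Module.End ℝ V} {p q : ℝ} (hp : 0 < p) (hq : 0 < q)
    (h1 : y * a - a * y = p • x) (h2 : y * x - x * y = -(q • a)) :
    ∃ E : V ≃ₗ[ℝ] V, (∀ v, E (a v) = -a (E v)) ∧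
      (∀ z : Module.End ℝ V, y * z = z * y → ∀ v, E (z v) = z (E v)) ∧
      (∀ S : Submodule ℝ V, (∀ v ∈ S, y v ∈ S) → ∀ v ∈ S, E v ∈ S) := by
  let e := (Module.finBasis ℝ V).equivFun
  let : NormedAddCommGroup V := NormedAddCommGroup.induced V _ e e.injective
  let : NormedSpace ℝ V := NormedSpace.induced ℝ V _ e
  have : CompleteSpace V := FiniteDimensional.complete ℝ V
  let T : Module.End ℝ V ≃ₗ[ℝ] (V →L[ℝ] V) := LinearMap.toContinuousLinearMap
  let : NormedAlgebra ℚ (V →L[ℝ] V) := NormedAlgebra.restrictScalars ℚ ℝ _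
  have hTm : ∀ f g, T (f * g) = T f * T g := fun f g => by ext v; rfl
  obtain ⟨t, ht⟩ := exp_conj_eq_neg (y := T y) (a := T a) (x := T x) hp hq
    (by rw [← hTm, ← hTm, ← map_sub, h1, map_smul])
    (by rw [← hTm, ← hTm, ← map_sub, h2, map_neg, map_smul])
  set F : V →L[ℝ] V := NormedSpace.exp (t • T y) with hF
  set F' : V →L[ℝ] V := NormedSpace.exp (-(t • T y)) with hF'
  have hFF' : F * F' = 1 := by
    rw [hF, hF', ← NormedSpace.exp_add_of_commute ((Commute.refl (t • T y)).neg_right)]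
    simp
  have hF'F : F' * F = 1 := by
    rw [hF, hF', ← NormedSpace.exp_add_of_commute ((Commute.refl (t • T y)).neg_left)]
    simp
  refine ⟨LinearEquiv.ofLinearMap F F' (by ext v; exact DFunLike.congr_fun hFF' v)
    (by ext v; exact DFunLike.congr_fun hF'F v), ?_, ?_, ?_⟩
  · intro v
    exact DFunLike.congr_fun ht v
  · intro z hz v
    have hc : Commute (T y) (T z) := by
      change T y * T z = T z * T y
      rw [← hTm, ← hTm, hz]
    have := ((hc.smul_left t).exp_left).eq
    exact DFunLike.congr_fun this v
  · intro S hS v hv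
    -- The partial sums of the exponential series preserve `S`, and `S` is closed because the
    -- dimension is finite.
    have hsum := NormedSpace.exp_series_hasSum_exp' (𝕂 := ℝ) (t • T y)
    have hsum' := hsum.mapL (ContinuousLinearMap.apply ℝ V v)
    have hcl : IsClosed (S : Set V) := S.closed_of_finiteDimensional
    refine hcl.mem_of_tendsto hsum' (Filter.Eventually.of_forall fun s => ?_)
    refine S.sum_mem fun n _ => ?_
    have : ∀ n : ℕ, ((t • T y) ^ n) v ∈ S := by
      intro n
      induction n with
      | zero => simpa using hv
      | succ n ih =>
        rw [pow_succ']
        exact S.smul_mem _ (hS _ ih)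
    exact S.smul_mem _ (this n)

end LieTriple

namespace LieTriple

universe u

/-! ### Operators acting on multilinear forms -/

section Forms

variable {W : Type*} [AddCommGroup W] [Module ℝ W] {J : Type*} [Fintype J] [DecidableEq J]

/-- The infinitesimal action `(f · ω)(x₁, …) = ∑ i, ω(…, f xᵢ, …)` of operators on forms. -/
def formAction (W : Type*) [AddCommGroup W] [Module ℝ W] (J : Type*) [Fintype J] [DecidableEq J] :
    Module.End ℝ W →ₗ[ℝ] Module.End ℝ (MultilinearMap ℝ (fun _ : J => W) ℝ) :=
  ∑ i : J, (MultilinearMap.compLinearMapMultilinear (R := ℝ) (M₁ := fun _ : J => W)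
    (M₁' := fun _ : J => W) (M₂ := ℝ)).toLinearMap (fun _ => LinearMap.id) i

theorem formAction_apply (f : Module.End ℝ W) (w : MultilinearMap ℝ (fun _ : J => W) ℝ)
    (x : J → W) :
    formAction W J f w x = ∑ i, w (Function.update x i (f (x i))) := by
  simp only [formAction, LinearMap.sum_apply, _root_.sum_apply]
  refine Finset.sum_congr rfl fun i _ => ?_
  change w (fun j => (Function.update (fun _ => LinearMap.id) i f : J → Module.End ℝ W) j (x j)) = _
  congr 1
  funext j
  by_cases h : j = i
  · subst h; simp
  · simp [h]

/-- Precomposition reverses order, whence the sign; composing with `-D` below restores a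
representation. Terms acting in two different slots cancel. -/
theorem formAction_commutator (f g : Module.End ℝ W) :
    formAction W J f * formAction W J g - formAction W J g * formAction W J f
      = formAction W J (g * f - f * g) := by
  ext w x
  have key : ∀ f g : Module.End ℝ W, (formAction W J f * formAction W J g) w x =
      ∑ i, ∑ k, w (Function.update (Function.update x i (f (x i))) k
        (g (Function.update x i (f (x i)) k))) := by
    intro f g
    simp only [Module.End.mul_apply, formAction_apply]
  rw [LinearMap.sub_apply, _root_.sub_apply, key, key, map_sub, LinearMap.sub_apply,
    _root_.sub_apply, formAction_apply, formAction_apply,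
    Finset.sum_comm (f := fun i k => w (Function.update (Function.update x i (g (x i))) k
        (f (Function.update x i (g (x i)) k)))), ← Finset.sum_sub_distrib,
    ← Finset.sum_sub_distrib]
  refine Finset.sum_congr rfl fun i _ => ?_
  rw [← Finset.sum_sub_distrib, Finset.sum_eq_single i]
  · simp
  · intro k _ hk
    rw [Function.update_of_ne hk, Function.update_of_ne (Ne.symm hk), Function.update_comm hk,
      sub_self]
  · simp

/-- The determinant of the `J`-coordinates as a multilinear form. -/
def detForm (π : W →ₗ[ℝ] (J → ℝ)) : MultilinearMap ℝ (fun _ : J => W) ℝ :=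
  (Matrix.detRowAlternating (R := ℝ) (n := J)).toMultilinearMap.compLinearMap (fun _ => π)

theorem detForm_apply (π : W →ₗ[ℝ] (J → ℝ)) (x : J → W) :
    detForm π x = Matrix.det (Matrix.of fun i => π (x i)) := rfl

/-- The derivative of the determinant is a trace: expanding along the changed row gives `tr (M N adj
M) = det M · tr N`. -/
theorem formAction_detForm {π : W →ₗ[ℝ] (J → ℝ)} {f : Module.End ℝ W} {N : Matrix J J ℝ}
    (h : ∀ w, π (f w) = Matrix.vecMul (π w) N) :
    formAction W J f (detForm π) = N.trace • detForm π := by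
  ext x
  rw [formAction_apply, _root_.smul_apply, detForm_apply]
  set M : Matrix J J ℝ := Matrix.of fun i => π (x i) with hM
  have h1 : ∀ i, detForm π (Function.update x i (f (x i))) =
      ∑ j, (M * N) i j * M.adjugate j i := by
    intro i
    have e : (Matrix.of fun k => π (Function.update x i (f (x i)) k))
        = M.updateRow i ((M * N) i) := by
      ext k j
      by_cases hk : k = i
      · subst hk
        simp only [Matrix.of_apply, Function.update_self, Matrix.updateRow_self, h]
        rfl
      · simp [hk, hM]
    rw [detForm_apply, e, ← Matrix.cramer_transpose_apply, Matrix.cramer_eq_adjugate_mulVec,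
      ← Matrix.adjugate_transpose]
    simp only [Matrix.mulVec, dotProduct, Matrix.transpose_apply]
    exact Finset.sum_congr rfl fun j _ => mul_comm _ _
  simp only [h1]
  have h2 : ∑ i, ∑ j, (M * N) i j * M.adjugate j i = (M * N * M.adjugate).trace := by
    simp only [Matrix.trace, Matrix.diag, Matrix.mul_apply (M := M * N)]
  rw [h2, Matrix.mul_assoc, Matrix.trace_mul_comm, Matrix.mul_assoc, Matrix.adjugate_mul,
    Matrix.mul_smul, Matrix.mul_one, Matrix.trace_smul, smul_eq_mul, smul_eq_mul, mul_comm]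

end Forms

/-! ### Extremal weights in representations -/

section Representations

variable {W : Type u} [AddCommGroup W] [Module ℝ W]

/-- A representation of the bracket `(x, y) ↦ D x y` on a vector space `V`. -/
def IsBracketRep {V : Type*} [AddCommGroup V] [Module ℝ V] (D : W →ₗ[ℝ] Module.End ℝ W)
    (ρ : W →ₗ[ℝ] Module.End ℝ V) : Prop :=
  ∀ x y, ρ (D x y) = ρ x * ρ y - ρ y * ρ x

/-- `A` and `B` act by similar operators in every finite-dimensional representation. -/
def IsRepConj (D : W →ₗ[ℝ] Module.End ℝ W) (A B : W) : Prop :=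
  ∀ (V : Type u) [AddCommGroup V] [Module ℝ V] [FiniteDimensional ℝ V]
    (ρ : W →ₗ[ℝ] Module.End ℝ V), IsBracketRep D ρ →
      ∃ E : V ≃ₗ[ℝ] V, ∀ v, E (ρ A v) = ρ B (E v)

theorem IsRepConj.refl (D : W →ₗ[ℝ] Module.End ℝ W) (A : W) : IsRepConj D A A :=
  fun V _ _ _ _ _ => ⟨LinearEquiv.refl ℝ V, fun _ => rfl⟩

theorem IsRepConj.symm {D : W →ₗ[ℝ] Module.End ℝ W} {A B : W} (h : IsRepConj D A B) :
    IsRepConj D B A := by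
  intro V _ _ _ ρ hρ
  obtain ⟨E, hE⟩ := h V ρ hρ
  refine ⟨E.symm, fun v => ?_⟩
  rw [LinearEquiv.symm_apply_eq, hE, LinearEquiv.apply_symm_apply]

theorem IsRepConj.trans {D : W →ₗ[ℝ] Module.End ℝ W} {A B C : W} (h : IsRepConj D A B)
    (h' : IsRepConj D B C) : IsRepConj D A C := by
  intro V _ _ _ ρ hρ
  obtain ⟨E, hE⟩ := h V ρ hρ
  obtain ⟨F, hF⟩ := h' V ρ hρ
  exact ⟨E.trans F, fun v => by simp [hE, hF]⟩

/-- Rotating `A` to `-A` in the plane spanned by `A` and `x` fixes everything killed by `y`. -/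
theorem isRepConj_of_rotation {D : W →ₗ[ℝ] Module.End ℝ W} {y A x z : W} {p q : ℝ}
    (hp : 0 < p) (hq : 0 < q) (h1 : D y A = p • x) (h2 : D y x = -(q • A)) (h3 : D y z = 0) :
    IsRepConj D (A + z) (-A + z) := by
  intro V _ _ _ ρ hρ
  obtain ⟨E, hE, hEz, -⟩ := exists_equiv_conj_eq_neg (y := ρ y) (a := ρ A) (x := ρ x) hp hq
    (by rw [← hρ, h1, map_smul]) (by rw [← hρ, h2, map_neg, map_smul])
  refine ⟨E, fun v => ?_⟩
  have hz : ρ y * ρ z = ρ z * ρ y := by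
    rw [← sub_eq_zero, ← hρ, h3, map_zero]
  simp [hE, hEz _ hz]

variable {ι : Type*} {D : W →ₗ[ℝ] Module.End ℝ W}

/-- If `v` is an extremal vector with respect to `A`, and `B` acts by nonnegative weights on the
raising operators, then the `A`-weight of `v` is at least its `B`-weight. -/
theorem weight_le_of_isRepConj (b : Module.Basis ι ℝ W) {A B : W} {α β : ι → ℝ}
    (hB : ∀ j, D B (b j) = β j • b j)
    (hαβ : ∀ j, 0 < α j → 0 ≤ β j) (hconj : IsRepConj D A B)
    {V : Type u} [AddCommGroup V] [Module ℝ V] [FiniteDimensional ℝ V]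
    {ρ : W →ₗ[ℝ] Module.End ℝ V} (hρ : IsBracketRep D ρ) {v : V} (hv : v ≠ 0) {r s : ℝ}
    (hvA : ρ A v = r • v) (hvB : ρ B v = s • v)
    (hlow : ∀ j, α j ≤ 0 → ∃ t : ℝ, ρ (b j) v = t • v) : s ≤ r := by
  let word : List ι → V := fun l => l.foldr (fun j w => ρ (b j) w) v
  -- `N` is the subrepresentation generated by `v`: words in raising operators suffice, since the
  -- other basis elements scale `v`. Raising never lowers the `B`-weight, so `B` has only
  -- eigenvalues `≥ s` on `N`; by similarity `r` is one of them.
  let N : Submodule ℝ V := Submodule.span ℝ {w | ∃ l : List ι, (∀ j ∈ l, 0 < α j) ∧ word l = w}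
  have hmem : ∀ l : List ι, (∀ j ∈ l, 0 < α j) → word l ∈ N :=
    fun l hl => Submodule.subset_span ⟨l, hl, rfl⟩
  have hraise : ∀ j, 0 < α j → ∀ w ∈ N, ρ (b j) w ∈ N := by
    intro j hj w hw
    induction hw using Submodule.span_induction with
    | mem w hw =>
      obtain ⟨l, hl, rfl⟩ := hw
      exact hmem (j :: l) (by simpa [hj] using hl)
    | zero => simp
    | add x y _ _ hx hy => rw [map_add]; exact N.add_mem hx hy
    | smul t x _ hx => rw [map_smul]; exact N.smul_mem t hx
  have hstab_word : ∀ l : List ι, (∀ j ∈ l, 0 < α j) → ∀ x, ρ x (word l) ∈ N := by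
    intro l
    induction l with
    | nil =>
      intro _ x
      have hx : x ∈ Submodule.span ℝ (Set.range b) := by simp [b.span_eq]
      induction hx using Submodule.span_induction with
      | zero => simp
      | smul t x _ hx => rw [map_smul, LinearMap.smul_apply]; exact N.smul_mem t hx
      | add x y _ _ hx hy => rw [map_add, LinearMap.add_apply]; exact N.add_mem hx hy
      | mem x hx =>
        obtain ⟨j, rfl⟩ := hx
        by_cases hj : 0 < α j
        · exact hmem [j] (by simpa using hj)
        · obtain ⟨t, ht⟩ := hlow j (not_lt.mp hj)
          change ρ (b j) v ∈ N
          rw [ht]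
          exact N.smul_mem t (hmem [] (by simp))
    | cons j l ih =>
      intro hl x
      have hl' : ∀ j ∈ l, 0 < α j := fun k hk => hl k (by simp [hk])
      have e : ρ x (word (j :: l)) = ρ (b j) (ρ x (word l)) + ρ (D x (b j)) (word l) := by
        rw [hρ]
        simp [word]
      rw [e]
      exact N.add_mem (hraise j (hl j (by simp)) _ (ih hl' x)) (ih hl' _)
  have hstab : ∀ x, ∀ w ∈ N, ρ x w ∈ N := by
    intro x w hw
    induction hw using Submodule.span_induction with
    | mem w hw =>
      obtain ⟨l, hl, rfl⟩ := hw
      exact hstab_word l hl x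
    | zero => simp
    | add x y _ _ hx hy => rw [map_add]; exact N.add_mem hx hy
    | smul t x _ hx => rw [map_smul]; exact N.smul_mem t hx
  have hword : ∀ l : List ι, (∀ j ∈ l, 0 < α j) → ∃ t, s ≤ t ∧ ρ B (word l) = t • word l := by
    intro l
    induction l with
    | nil => exact fun _ => ⟨s, le_rfl, hvB⟩
    | cons j l ih =>
      intro hl
      obtain ⟨t, ht, h⟩ := ih fun k hk => hl k (by simp [hk])
      refine ⟨β j + t, by linarith [hαβ j (hl j (by simp))], ?_⟩
      have e : ρ B (word (j :: l)) = ρ (b j) (ρ B (word l)) + ρ (D B (b j)) (word l) := by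
        rw [hρ]
        simp [word]
      rw [e, h, hB, map_smul, map_smul, LinearMap.smul_apply, add_smul, add_comm]
      rfl
  have hNle : N ≤ ⨆ t : {t : ℝ // s ≤ t}, (ρ B).eigenspace t := by
    refine Submodule.span_le.mpr ?_
    rintro _ ⟨l, hl, rfl⟩
    obtain ⟨t, ht, h⟩ := hword l hl
    exact Submodule.mem_iSup_of_mem (⟨t, ht⟩ : {t : ℝ // s ≤ t})
      (Module.End.mem_eigenspace_iff.mpr h)
  let ρN : W →ₗ[ℝ] Module.End ℝ N :=
    { toFun := fun x => (ρ x).restrict (hstab x)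
      map_add' := fun x y => by ext w; simp
      map_smul' := fun t x => by ext w; simp }
  have hρN : IsBracketRep D ρN := by
    intro x y
    ext w
    simp [ρN, hρ x y]
  obtain ⟨E, hE⟩ := hconj N ρN hρN
  let v' : N := ⟨v, hmem [] (by simp)⟩
  have hv' : ρN A v' = r • v' := Subtype.ext hvA
  have hEv : ρ B (E v' : V) = r • (E v' : V) := by
    have := hE v'
    rw [hv', map_smul] at this
    exact (congrArg Subtype.val this).symm
  have hEv0 : (E v' : V) ≠ 0 := by
    intro h0
    have h1 : v' = 0 := by simpa using h0
    exact hv (congrArg Subtype.val h1)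
  by_contra! hlt
  have hdisj := (Module.End.eigenspaces_iSupIndep (ρ B)) r
  refine hEv0 (Submodule.disjoint_def.mp hdisj _ (Module.End.mem_eigenspace_iff.mpr hEv) ?_)
  refine (iSup_le fun t => ?_ : (⨆ t : {t : ℝ // s ≤ t}, (ρ B).eigenspace t) ≤ _)
    (hNle (E v').2)
  exact le_iSup₂_of_le (t : ℝ) (by have := t.2; intro h; linarith) le_rfl

/-- Comparison of the partial sums of the eigenvalues of `A` and of `B`. -/
theorem sum_filter_le_of_isRepConj [Fintype ι] [FiniteDimensional ℝ W]
    (hD : IsBracketRep D D) (b : Module.Basis ι ℝ W) {A B : W} {α β : ι → ℝ}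
    (hA : ∀ j, D A (b j) = α j • b j) (hB : ∀ j, D B (b j) = β j • b j)
    (hαβ : ∀ j, 0 < α j → 0 ≤ β j) (hconj : IsRepConj D A B) (c : ℝ) :
    ∑ j with c ≤ α j, α j ≤ ∑ j with c ≤ α j, β j := by
  classical
  -- Indexing by a subtype of `Fin` keeps the space of forms in the universe over which `IsRepConj`
  -- quantifies.
  let J := {j : Fin (Fintype.card ι) // c ≤ α ((Fintype.equivFin ι).symm j)}
  let jι : J → ι := fun j => (Fintype.equivFin ι).symm j
  have hjι : Function.Injective jι := fun i j h => Subtype.ext ((Equiv.injective _) h)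
  let π : W →ₗ[ℝ] (J → ℝ) := LinearMap.pi fun j => b.coord (jι j)
  let ρ : W →ₗ[ℝ] Module.End ℝ (MultilinearMap ℝ (fun _ : J => W) ℝ) :=
    formAction W J ∘ₗ (-D)
  have hρ : IsBracketRep D ρ := by
    intro x y
    change formAction W J (-(D (D x y))) = formAction W J (-(D x)) * formAction W J (-(D y))
      - formAction W J (-(D y)) * formAction W J (-(D x))
    rw [formAction_commutator, hD]
    congr 1
    noncomm_ring
  -- If `D x` preserves `ker π`, the span of the `b i` with `α i < c`, it acts on the quotient by a
  -- matrix `N`, and the determinant form is scaled by `-tr N`.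
  have hlow : ∀ x : W, (∀ i, α i < c → π (D x (b i)) = 0) →
      ρ x (detForm π) = -(∑ j : J, b.coord (jι j) (D x (b (jι j)))) • detForm π := by
    intro x hx
    let N : Matrix J J ℝ := Matrix.of fun l j => b.coord (jι j) (D x (b (jι l)))
    have hN : ∀ w, π (D x w) = Matrix.vecMul (π w) N := by
      have : π ∘ₗ D x = (Matrix.vecMulLinear N) ∘ₗ π := by
        refine b.ext fun i => ?_
        by_cases hi : c ≤ α i
        · let l : J := ⟨Fintype.equivFin ι i, by simpa using hi⟩
          have hl : i = jι l := by simp [jι, l]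
          have hπ : π (b i) = Pi.single l 1 := by
            ext j
            simp only [π, LinearMap.pi_apply, Module.Basis.coord_apply, hl,
              Module.Basis.repr_self, Finsupp.single_apply, Pi.single_apply, hjι.eq_iff]
            simp [eq_comm]
          simp only [LinearMap.comp_apply, hπ, Matrix.vecMulLinear_apply, Matrix.single_one_vecMul]
          ext j
          simp [π, N, hl, Matrix.row]
        · have hπ : π (b i) = 0 := by
            ext j
            have hne : i ≠ jι j := by
              rintro rfl
              exact hi j.2
            simp [π, hne]
          simp [LinearMap.comp_apply, hπ, hx i (not_le.mp hi)]
      exact fun w => LinearMap.congr_fun this w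
    have := formAction_detForm (f := -(D x)) (N := -N) (π := π) fun w => by
      rw [LinearMap.neg_apply, map_neg, hN, Matrix.vecMul_neg]
    rw [Matrix.trace_neg] at this
    exact this
  have hdiag : ∀ x : W, ∀ γ : ι → ℝ, (∀ j, D x (b j) = γ j • b j) →
      ρ x (detForm π) = -(∑ j : J, γ (jι j)) • detForm π := by
    intro x γ hx
    rw [hlow x]
    · simp [hx]
    · intro i hi
      ext j
      have hne : i ≠ jι j := by
        rintro rfl
        exact absurd j.2 (not_le.mpr hi)
      simp [π, hx, hne]
  have hne : detForm π ≠ 0 := by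
    intro h0
    have h1 : detForm π (fun j : J => b (jι j)) = 1 := by
      rw [detForm_apply]
      convert! Matrix.det_one (n := J) (R := ℝ)
      ext i j
      simp [π, Finsupp.single_apply, hjι.eq_iff, Matrix.one_apply]
    rw [h0] at h1
    simp at h1
  -- The determinant form is extremal: for `α j ≤ 0`, `D (b j)` does not raise the `A`-weight, so it
  -- preserves `ker π`. The weights to be compared are minus the two partial sums.
  have key := weight_le_of_isRepConj (D := D) b hB hαβ hconj hρ hne (hdiag A α hA) (hdiag B β hB)
    (fun j hj => ⟨_, hlow (b j) fun i hi => by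
      have e : D A (D (b j) (b i)) = (α j + α i) • D (b j) (b i) := by
        have h := LinearMap.congr_fun (hD A (b j)) (b i)
        simp only [hA, map_smul, LinearMap.smul_apply, LinearMap.sub_apply,
          Module.End.mul_apply] at h
        rw [add_smul, h]
        abel
      ext k
      have hk : ∀ w, b.coord (jι k) (D A w) = α (jι k) * b.coord (jι k) w := by
        intro w
        have : b.coord (jι k) ∘ₗ D A = α (jι k) • b.coord (jι k) := by
          refine b.ext fun l => ?_
          by_cases hl : l = jι k
          · simp [hA, hl]
          · simp [hA, hl]
        exact LinearMap.congr_fun this w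
      have h2 := hk (D (b j) (b i))
      rw [e, map_smul, smul_eq_mul] at h2
      have h3 : (α (jι k) - (α j + α i)) * b.coord (jι k) (D (b j) (b i)) = 0 := by linarith
      have hk2 : c ≤ α (jι k) := k.2
      exact (mul_eq_zero.mp h3).resolve_left (by intro h; linarith)⟩)
  have hsum : ∀ γ : ι → ℝ, ∑ j : J, γ (jι j) = ∑ j with c ≤ α j, γ j := by
    intro γ
    refine Finset.sum_bij (fun j _ => jι j) (fun j _ => by simpa using j.2)
      (fun i _ j _ h => hjι h) (fun i hi => ?_) (fun _ _ => rfl)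
    exact ⟨⟨Fintype.equivFin ι i, by simpa using hi⟩, Finset.mem_univ _, by simp [jι]⟩
  rw [hsum, hsum] at key
  linarith

open MeasureTheory in
/-- Abel summation, in integral form. -/
theorem sum_mul_nonneg_of_sum_filter_nonneg {ι : Type*} [Fintype ι] {α d : ι → ℝ}
    (h : ∀ c : ℝ, 0 ≤ ∑ j with c ≤ α j, d j) (hd : ∑ j, d j = 0) :
    0 ≤ ∑ j, α j * d j := by
  classical
  obtain ⟨M, hM⟩ : ∃ M : ℝ, ∀ j, -M ≤ α j :=
    ⟨∑ j, |α j|, fun j => by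
      have := Finset.single_le_sum (f := fun j => |α j|) (fun _ _ => abs_nonneg _)
        (Finset.mem_univ j)
      linarith [neg_abs_le (α j)]⟩
  -- At each `t ≥ -M` the sum of these indicators is the partial sum over `t ≤ α j`. The shift by
  -- `M` disappears at the end because the `d j` sum to zero.
  have hint : ∀ j, ∫ t, (Set.Icc (-M) (α j)).indicator (fun _ => d j) t = (α j + M) * d j := by
    intro j
    rw [integral_indicator measurableSet_Icc, setIntegral_const, Real.volume_real_Icc_of_le (hM j)]
    simp
  have hI : ∫ t, ∑ j, (Set.Icc (-M) (α j)).indicator (fun _ => d j) t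
      = ∑ j, (α j + M) * d j := by
    rw [integral_finsetSum]
    · simp [hint]
    · intro j _
      exact (integrable_indicator_iff measurableSet_Icc).mpr
        (by simp)
  have hpos : 0 ≤ ∫ t, ∑ j, (Set.Icc (-M) (α j)).indicator (fun _ => d j) t := by
    refine integral_nonneg fun t => ?_
    by_cases ht : -M ≤ t
    · have := h t
      rw [Finset.sum_filter] at this
      refine this.trans_eq (Finset.sum_congr rfl fun j _ => ?_)
      simp [Set.indicator_apply, ht]
    · simp [ht]
  rw [hI] at hpos
  simp only [add_mul, Finset.sum_add_distrib, ← Finset.mul_sum, hd] at hpos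
  linarith

/-- Conjugate elements whose weights have the same signs have the same weights. -/
theorem weight_eq_of_isRepConj [Fintype ι] [FiniteDimensional ℝ W]
    (hD : IsBracketRep D D) (b : Module.Basis ι ℝ W) {A B : W} {α β : ι → ℝ}
    (hA : ∀ j, D A (b j) = α j • b j) (hB : ∀ j, D B (b j) = β j • b j)
    (hαβ : ∀ j, 0 < α j → 0 ≤ β j) (hconj : IsRepConj D A B) (j : ι) : α j = β j := by
  classical
  obtain ⟨E, hE⟩ := hconj W D hD
  have hEc : E.conj (D A) = D B := by
    ext w
    rw [LinearEquiv.conj_apply_apply, hE, LinearEquiv.apply_symm_apply]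
  have htr : ∀ (x : W) (γ : ι → ℝ), (∀ j, D x (b j) = γ j • b j) →
      LinearMap.trace ℝ W (D x) = ∑ j, γ j ∧
      LinearMap.trace ℝ W (D x * D x) = ∑ j, γ j * γ j := by
    intro x γ hx
    constructor
    · rw [LinearMap.trace_eq_matrix_trace ℝ b]
      simp [Matrix.trace, LinearMap.toMatrix_apply, hx]
    · rw [LinearMap.trace_eq_matrix_trace ℝ b]
      simp [Matrix.trace, LinearMap.toMatrix_apply, hx]
  have h1 : ∑ j, β j = ∑ j, α j := by
    rw [← (htr B β hB).1, ← (htr A α hA).1, ← hEc, LinearMap.trace_conj']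
  have h2 : ∑ j, β j * β j = ∑ j, α j * α j := by
    have : D B * D B = E.conj (D A * D A) := by
      rw [← hEc]
      exact (E.conj_comp _ _).symm
    rw [← (htr B β hB).2, ← (htr A α hA).2, this, LinearMap.trace_conj']
  have h3 : 0 ≤ ∑ j, α j * (β j - α j) := by
    refine sum_mul_nonneg_of_sum_filter_nonneg (fun c => ?_) ?_
    · rw [Finset.sum_sub_distrib]
      linarith [sum_filter_le_of_isRepConj hD b hA hB hαβ hconj c]
    · rw [Finset.sum_sub_distrib]
      linarith
  -- `∑ (β - α)² = ∑ β² - ∑ α² - 2 ∑ α (β - α)`: the squares cancel by `h2`, and the last sum is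
  -- nonnegative by `h3`.
  have h4 : ∑ j, (β j - α j) ^ 2 ≤ 0 := by
    have : ∑ j, (β j - α j) ^ 2
        = (∑ j, β j * β j - ∑ j, α j * α j) - 2 * ∑ j, α j * (β j - α j) := by
      rw [Finset.mul_sum, ← Finset.sum_sub_distrib, ← Finset.sum_sub_distrib]
      exact Finset.sum_congr rfl fun j _ => by ring
    rw [this, h2]
    linarith
  have h5 := (Finset.sum_eq_zero_iff_of_nonneg fun j _ => sq_nonneg (β j - α j)).mp
    (le_antisymm h4 (Finset.sum_nonneg fun j _ => sq_nonneg _)) j (Finset.mem_univ j)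
  have := pow_eq_zero_iff (two_ne_zero) |>.mp h5
  linarith

end Representations

end LieTriple

namespace LieTriple

universe u

variable {𝔤 : Type u} [LieRing 𝔤] [LieAlgebra ℝ 𝔤]

/-! ### The invariant inner product -/

theorem metric_apply (c : ℝ) (X Y : 𝔤) : metric 𝔤 c X Y = -c * killingForm ℝ 𝔤 X Y := rfl

theorem metric_comm (c : ℝ) (X Y : 𝔤) : metric 𝔤 c X Y = metric 𝔤 c Y X := by
  rw [metric_apply, metric_apply, LieModule.traceForm_comm]

theorem metric_lie (c : ℝ) (X Y Z : 𝔤) : metric 𝔤 c ⁅X, Y⁆ Z = metric 𝔤 c X ⁅Y, Z⁆ := by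
  rw [metric_apply, metric_apply, LieModule.traceForm_apply_lie_apply]

theorem metric_pos (hcompact : KillingNegDef 𝔤) {c : ℝ} (hc : 0 < c) {X : 𝔤} (hX : X ≠ 0) :
    0 < metric 𝔤 c X X := by
  rw [metric_apply]
  nlinarith [hcompact X hX]

theorem metric_self_eq_zero (hcompact : KillingNegDef 𝔤) {c : ℝ} (hc : 0 < c) {X : 𝔤}
    (hX : metric 𝔤 c X X = 0) : X = 0 := by
  by_contra h
  exact (metric_pos hcompact hc h).ne' hX

/-- `ad Z` is skew for a definite form, so `ad Z ^ 2` and `ad Z` have the same kernel. -/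
theorem lie_eq_zero_of_lie_lie_eq_zero (hcompact : KillingNegDef 𝔤) {Z X : 𝔤}
    (h : ⁅Z, ⁅Z, X⁆⁆ = 0) : ⁅Z, X⁆ = 0 := by
  refine metric_self_eq_zero hcompact one_pos ?_
  have h1 : metric 𝔤 1 ⁅X, Z⁆ ⁅Z, X⁆ = 0 := by rw [metric_lie, h, map_zero]
  rwa [← lie_skew X Z, map_neg, LinearMap.neg_apply, neg_eq_zero] at h1

/-! ### Cartan subalgebras and root vectors -/

theorem finrank_le_rank [FiniteDimensional ℝ 𝔤]
    {m a : Submodule ℝ 𝔤} (ham : a ≤ m) (ha : IsFlat a) :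
    Module.finrank ℝ a ≤ rank m := by
  refine le_csSup ⟨Module.finrank ℝ 𝔤, ?_⟩ ⟨a, ham, ha, rfl⟩
  rintro _ ⟨b, -, -, rfl⟩
  exact b.finrank_le

/-- A Cartan subalgebra contains everything that commutes with it. -/
theorem IsCartan.mem_of_commute [FiniteDimensional ℝ 𝔤]
    {m a : Submodule ℝ 𝔤} (ha : IsCartan m a) {X : 𝔤} (hX : X ∈ m)
    (h : ∀ Z ∈ a, ⁅Z, X⁆ = 0) : X ∈ a := by
  -- Adjoining `X` keeps the subspace flat, so maximality of the dimension forces `X ∈ a`.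
  have hflat : IsFlat (a ⊔ ℝ ∙ X) := by
    intro U hU V hV
    obtain ⟨U, hUa, U', hU', rfl⟩ := Submodule.mem_sup.mp hU
    obtain ⟨V, hVa, V', hV', rfl⟩ := Submodule.mem_sup.mp hV
    obtain ⟨s, rfl⟩ := Submodule.mem_span_singleton.mp hU'
    obtain ⟨t, rfl⟩ := Submodule.mem_span_singleton.mp hV'
    have h' : ⁅X, V⁆ = 0 := by rw [← lie_skew, h V hVa, neg_zero]
    simp [ha.2.1 U hUa V hVa, h U hUa, h']
  have hle : a ⊔ ℝ ∙ X ≤ m :=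
    sup_le ha.1 ((Submodule.span_singleton_le_iff_mem _ _).mpr hX)
  have heq : a = a ⊔ ℝ ∙ X :=
    Submodule.eq_of_le_of_finrank_le le_sup_left ((finrank_le_rank hle hflat).trans_eq ha.2.2.symm)
  rw [heq]
  exact Submodule.mem_sup_right (Submodule.mem_span_singleton_self X)

/-- The data attached to a root: `X` and `Y` are root vectors in `m` and `[m, m]`,
and `A` is the direction orthogonal to the kernel of the root. -/
structure RootTriple (c : ℝ) (m a : Submodule ℝ 𝔤) (α : Module.Dual ℝ a) (A : a) (X Y : 𝔤) :
    Prop where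
  pos : 0 < α A
  mem : X ∈ m
  mem_derived : Y ∈ derived m
  lie_left : ∀ Z : a, ⁅(Z : 𝔤), X⁆ = α Z • Y
  lie_right : ∀ Z : a, ⁅(Z : 𝔤), Y⁆ = -(α Z • X)
  lie_eq : ⁅X, Y⁆ = A
  metric_eq : ∃ s : ℝ, 0 < s ∧ ∀ Z : a, metric 𝔤 c (Z : 𝔤) (A : 𝔤) = s * α Z

/-- Take a root vector `X`, some `Z₀` with `α Z₀ = 1`, and `Y = [Z₀, X]`. The element `[X, Y]`
commutes with `a`, hence lies in it by maximality. Invariance of the form gives `⟨Z, [X, Y]⟩ = ⟨X,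
X⟩ α(Z)`, so this element is normal to `ker α` and `α` is positive on it. -/
theorem exists_rootTriple [FiniteDimensional ℝ 𝔤]
    (hcompact : KillingNegDef 𝔤) {c : ℝ} (hc : 0 < c)
    {m a : Submodule ℝ 𝔤} (hm : IsLieTripleSystem m) (ha : IsCartan m a)
    {α : Module.Dual ℝ a} (hα : α ∈ roots m a) :
    ∃ (A : a) (X Y : 𝔤), RootTriple c m a α A X Y := by
  obtain ⟨hα0, hne⟩ := hα
  obtain ⟨X, ⟨hXm, hX⟩, hX0⟩ := (Submodule.ne_bot_iff _).mp hne
  obtain ⟨Z₀, hZ₀⟩ : ∃ Z₀, α Z₀ = 1 := by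
    obtain ⟨Z, hZ⟩ : ∃ Z, α Z ≠ 0 := by
      by_contra! h
      exact hα0 (LinearMap.ext h)
    exact ⟨(α Z)⁻¹ • Z, by simp [hZ]⟩
  have hflat : ∀ Z Z' : a, ⁅(Z : 𝔤), (Z' : 𝔤)⁆ = 0 := fun Z Z' => ha.2.1 _ Z.2 _ Z'.2
  have hker : ∀ Z : a, α Z = 0 → ⁅(Z : 𝔤), X⁆ = 0 := fun Z hZ =>
    lie_eq_zero_of_lie_lie_eq_zero hcompact (by rw [hX Z, hZ]; simp)
  set Y : 𝔤 := ⁅(Z₀ : 𝔤), X⁆ with hY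
  have hleft : ∀ Z : a, ⁅(Z : 𝔤), X⁆ = α Z • Y := by
    intro Z
    have h := hker (Z - α Z • Z₀) (by simp [hZ₀])
    rw [← sub_eq_zero, ← h]
    simp [hY]
  have hright : ∀ Z : a, ⁅(Z : 𝔤), Y⁆ = -(α Z • X) := by
    intro Z
    have h1 : ⁅(Z : 𝔤), Y⁆ = ⁅(Z₀ : 𝔤), ⁅(Z : 𝔤), X⁆⁆ := by
      rw [hY, leibniz_lie, hflat, zero_lie, zero_add]
    rw [h1, hleft, lie_smul, hY, hX, hZ₀]
    simp
  have hYm : Y ∈ derived m := Submodule.subset_span ⟨Z₀, ha.1 Z₀.2, X, hXm, rfl⟩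
  have hXYm : ⁅X, Y⁆ ∈ m := by
    rw [hY, ← lie_skew]
    exact m.neg_mem (hm _ (ha.1 Z₀.2) _ hXm _ hXm)
  have hXYa : ⁅X, Y⁆ ∈ a := by
    refine ha.mem_of_commute hXYm fun Z hZ => ?_
    rw [leibniz_lie, hleft ⟨Z, hZ⟩, hright ⟨Z, hZ⟩]
    simp
  have hmetric : ∀ Z : a, metric 𝔤 c (Z : 𝔤) ⁅X, Y⁆ = metric 𝔤 c X X * α Z := by
    intro Z
    rw [metric_comm, metric_lie, ← lie_skew, hright, neg_neg, map_smul, smul_eq_mul, mul_comm]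
  have hXX := metric_pos hcompact hc hX0
  refine ⟨⟨⁅X, Y⁆, hXYa⟩, X, Y, ?_, hXm, hYm, hleft, hright, rfl, _, hXX, hmetric⟩
  have hA0 : ⁅X, Y⁆ ≠ 0 := by
    intro h0
    have := hmetric Z₀
    rw [h0, hZ₀, map_zero] at this
    linarith
  have h1 := metric_pos hcompact hc hA0
  have h2 := hmetric ⟨⁅X, Y⁆, hXYa⟩
  rw [h2] at h1
  exact pos_of_mul_pos_right h1 hXX.le

/-! ### Reflections, and the action of the Weyl group on the roots. -/

section

variable {c : ℝ} {m a : Submodule ℝ 𝔤} {α : Module.Dual ℝ a} {A : a} {X Y : 𝔤}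

theorem RootTriple.lie_swap (h : RootTriple c m a α A X Y) (Z : a) : ⁅Y, (Z : 𝔤)⁆ = α Z • X := by
  rw [← lie_skew, h.lie_right, neg_neg]

theorem RootTriple.lie_eq' (h : RootTriple c m a α A X Y) : ⁅Y, X⁆ = -(A : 𝔤) := by
  rw [← lie_skew, h.lie_eq]

theorem RootTriple.metric_ker (h : RootTriple c m a α A X Y) {Z : a} (hZ : α Z = 0) :
    metric 𝔤 c (Z : 𝔤) (A : 𝔤) = 0 := by
  obtain ⟨s, -, hs⟩ := h.metric_eq
  rw [hs, hZ, mul_zero]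

theorem RootTriple.apply_sub (h : RootTriple c m a α A X Y) (Z : a) :
    α (Z - (α Z / α A) • A) = 0 := by
  have := h.pos.ne'
  simp [this]

theorem IsOrthogonalReflection.apply_axis (h : RootTriple c m a α A X Y) {R : a ≃ₗ[ℝ] a}
    (hR : IsOrthogonalReflection c a α R) : R A = -A :=
  hR.2 A fun _ hZ => h.metric_ker hZ

theorem IsOrthogonalReflection.apply (h : RootTriple c m a α A X Y) {R : a ≃ₗ[ℝ] a}
    (hR : IsOrthogonalReflection c a α R) (Z : a) :
    R Z = -((α Z / α A) • A) + (Z - (α Z / α A) • A) := by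
  have e : Z = (α Z / α A) • A + (Z - (α Z / α A) • A) := by abel
  conv_lhs => rw [e]
  rw [map_add, map_smul, hR.apply_axis h, hR.1 _ (h.apply_sub Z), smul_neg]

theorem RootTriple.exists_reflection (h : RootTriple c m a α A X Y)
    (hcompact : KillingNegDef 𝔤) (hc : 0 < c) : ∃ R, IsOrthogonalReflection c a α R := by
  have h2 : α ((2 / α A) • A) = 2 := by
    have := h.pos.ne'
    simp [this]
  refine ⟨Module.reflection h2, fun Z hZ => by simp [Module.reflection_apply, hZ], fun Z hZ => ?_⟩
  have hZA : Z = (α Z / α A) • A := by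
    set V : a := Z - (α Z / α A) • A with hV
    have hαV : α V = 0 := h.apply_sub Z
    have h1 : metric 𝔤 c (V : 𝔤) (V : 𝔤) = 0 := by
      have e : metric 𝔤 c (V : 𝔤) (V : 𝔤)
          = metric 𝔤 c (V : 𝔤) (Z : 𝔤) - (α Z / α A) • metric 𝔤 c (V : 𝔤) (A : 𝔤) := by
        rw [← map_smul, ← map_sub]
        rfl
      rw [e, hZ V hαV, h.metric_ker hαV]
      simp
    have h2 : V = 0 := Subtype.ext (metric_self_eq_zero hcompact hc h1)
    exact sub_eq_zero.mp (hV ▸ h2)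
  rw [Module.reflection_apply, smul_smul]
  conv_rhs => rw [hZA]
  have e : α Z * (2 / α A) = 2 * (α Z / α A) := by ring
  conv_lhs => rw [e]
  conv_lhs => arg 1; rw [hZA]
  rw [mul_smul, two_smul]
  abel

theorem derived_lie_mem (hm : IsLieTripleSystem m) {T X : 𝔤} (hT : T ∈ derived m) (hX : X ∈ m) :
    ⁅T, X⁆ ∈ m := by
  induction hT using Submodule.span_induction with
  | mem T hT =>
    obtain ⟨U, hU, V, hV, rfl⟩ := hT
    exact hm U hU V hV X hX
  | zero => simp
  | add S T _ _ hS hT => rw [add_lie]; exact m.add_mem hS hT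
  | smul t T _ hT => rw [smul_lie]; exact m.smul_mem t hT

/-- Weyl group elements extend to automorphisms preserving the Lie triple system. -/
theorem exists_extension_of_mem_weylGroup [FiniteDimensional ℝ 𝔤]
    (hcompact : KillingNegDef 𝔤) (hc : 0 < c)
    (hm : IsLieTripleSystem m) (ha : IsCartan m a) {w : a ≃ₗ[ℝ] a} (hw : w ∈ weylGroup c m a) :
    ∃ E : 𝔤 ≃ₗ[ℝ] 𝔤, (∀ V ∈ m, E V ∈ m) ∧ ∀ (Z : a) (V : 𝔤), E ⁅(Z : 𝔤), V⁆ = ⁅(w Z : 𝔤), E V⁆ := by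
  induction hw using Subgroup.closure_induction with
  | mem R hR =>
    obtain ⟨α, hα, hR⟩ := hR
    obtain ⟨A, X, Y, h⟩ := exists_rootTriple hcompact hc hm ha hα
    have hcomm : ∀ S T : 𝔤, LieAlgebra.ad ℝ 𝔤 S * LieAlgebra.ad ℝ 𝔤 T
        - LieAlgebra.ad ℝ 𝔤 T * LieAlgebra.ad ℝ 𝔤 S = LieAlgebra.ad ℝ 𝔤 ⁅S, T⁆ := fun S T => by
      ext V
      simp
    obtain ⟨E, hEA, hEz, hEm⟩ := exists_equiv_conj_eq_neg (y := LieAlgebra.ad ℝ 𝔤 Y)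
      (a := LieAlgebra.ad ℝ 𝔤 (A : 𝔤)) (x := LieAlgebra.ad ℝ 𝔤 X) h.pos one_pos
      (by rw [hcomm, h.lie_swap, map_smul]) (by rw [hcomm, h.lie_eq', map_neg, one_smul])
    refine ⟨E, hEm m fun V hV => derived_lie_mem hm h.mem_derived hV, fun Z V => ?_⟩
    have hker : ∀ Z' : a, α Z' = 0 → E ⁅(Z' : 𝔤), V⁆ = ⁅(Z' : 𝔤), E V⁆ := by
      intro Z' hZ'
      refine hEz (LieAlgebra.ad ℝ 𝔤 (Z' : 𝔤)) ?_ V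
      rw [← sub_eq_zero, hcomm, h.lie_swap, hZ', zero_smul, map_zero]
    have hA : E ⁅(A : 𝔤), V⁆ = -⁅(A : 𝔤), E V⁆ := hEA V
    have h0 := hker _ (h.apply_sub Z)
    rw [hR.apply h Z]
    set t := α Z / α A
    set U : a := Z - t • A with hU
    have e1 : ⁅(Z : 𝔤), V⁆ = t • ⁅(A : 𝔤), V⁆ + ⁅(U : 𝔤), V⁆ := by
      rw [← smul_lie, ← add_lie, hU, Submodule.coe_sub, Submodule.coe_smul, add_sub_cancel]
    rw [e1, map_add, map_smul, hA, h0, Submodule.coe_add, Submodule.coe_neg, Submodule.coe_smul,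
      add_lie, neg_lie, smul_lie, smul_neg]
  | one => exact ⟨LinearEquiv.refl ℝ 𝔤, fun V hV => hV, fun Z V => rfl⟩
  | mul w₁ w₂ _ _ h₁ h₂ =>
    obtain ⟨E₁, hE₁, h₁⟩ := h₁
    obtain ⟨E₂, hE₂, h₂⟩ := h₂
    exact ⟨E₂.trans E₁, fun V hV => hE₁ _ (hE₂ V hV), fun Z V => by
      simp only [LinearEquiv.trans_apply, h₁, h₂, LinearEquiv.mul_apply]⟩
  | inv w _ h =>
    obtain ⟨E, hE, h⟩ := h
    -- Inclusion is equality by dimension, so the inverse of `E` preserves `m` too.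
    have hmap : m.map (E : 𝔤 →ₗ[ℝ] 𝔤) = m := by
      refine Submodule.eq_of_le_of_finrank_le ?_ (LinearEquiv.finrank_map_eq E m).ge
      rintro _ ⟨V, hV, rfl⟩
      exact hE V hV
    refine ⟨E.symm, fun V hV => ?_, fun Z V => ?_⟩
    · rw [← hmap] at hV
      obtain ⟨U, hU, rfl⟩ := hV
      simpa using hU
    · rw [LinearEquiv.symm_apply_eq, h]
      simp

/-- The extension of `w` to `𝔤` carries the root space of `β` into that of `β ∘ w⁻¹`. -/
theorem comp_inv_mem_roots [FiniteDimensional ℝ 𝔤] (hcompact : KillingNegDef 𝔤) (hc : 0 < c)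
    (hm : IsLieTripleSystem m) (ha : IsCartan m a) {w : a ≃ₗ[ℝ] a} (hw : w ∈ weylGroup c m a)
    {β : Module.Dual ℝ a} (hβ : β ∈ roots m a) :
    β ∘ₗ ((w⁻¹ : a ≃ₗ[ℝ] a) : a →ₗ[ℝ] a) ∈ roots m a := by
  obtain ⟨E, hEm, hE⟩ := exists_extension_of_mem_weylGroup hcompact hc hm ha hw
  have hww : ∀ Z, w (w⁻¹ Z) = Z := fun Z => by rw [← LinearEquiv.mul_apply, mul_inv_cancel]; rfl
  refine ⟨fun h0 => hβ.1 ?_, ?_⟩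
  · ext Z
    have := LinearMap.congr_fun h0 (w Z)
    rwa [LinearMap.comp_apply, LinearEquiv.coe_coe, ← LinearEquiv.mul_apply, inv_mul_cancel]
      at this
  · obtain ⟨V, ⟨hVm, hV⟩, hV0⟩ := (Submodule.ne_bot_iff _).mp hβ.2
    refine (Submodule.ne_bot_iff _).mpr ⟨E V, ⟨hEm V hVm, fun Z => ?_⟩, by simpa using hV0⟩
    have h1 := hE (w⁻¹ Z) V
    have h2 := hE (w⁻¹ Z) ⁅((w⁻¹ Z : a) : 𝔤), V⁆
    rw [hww] at h1 h2
    rw [← h1, ← h2, hV, map_smul]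
    rfl

theorem image_roots_eq [FiniteDimensional ℝ 𝔤] (hcompact : KillingNegDef 𝔤) (hc : 0 < c)
    (hm : IsLieTripleSystem m) (ha : IsCartan m a) {w : a ≃ₗ[ℝ] a} (hw : w ∈ weylGroup c m a) :
    (fun β : Module.Dual ℝ a => β ∘ₗ ((w⁻¹ : a ≃ₗ[ℝ] a) : a →ₗ[ℝ] a)) '' roots m a
      = roots m a := by
  refine Set.Subset.antisymm ?_ fun β hβ => ?_
  · rintro _ ⟨β, hβ, rfl⟩
    exact comp_inv_mem_roots hcompact hc hm ha hw hβ
  · refine ⟨_, comp_inv_mem_roots hcompact hc hm ha (inv_mem hw) hβ, ?_⟩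
    ext Z
    simp only [LinearMap.comp_apply, LinearEquiv.coe_coe, ← LinearEquiv.mul_apply]
    simp

end

end LieTriple

namespace LieTriple

universe u

/-! ### Joint diagonalization -/

/-- Commuting symmetric operators depending linearly on a parameter have a joint eigenbasis. -/
theorem exists_joint_eigenbasis {V : Type*} [AddCommGroup V] [Module ℝ V] [FiniteDimensional ℝ V]
    {P : Type*} [AddCommGroup P] [Module ℝ P] (F : LinearMap.BilinForm ℝ V)
    (hsymm : ∀ x y, F x y = F y x) (hpos : ∀ x, x ≠ 0 → 0 < F x x)
    (T : P →ₗ[ℝ] Module.End ℝ V) (hT : ∀ p x y, F (T p x) y = F x (T p y))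
    (hcomm : ∀ p q, T p * T q = T q * T p) :
    ∃ (ι : Type) (_ : Fintype ι) (b : Module.Basis ι ℝ V) (w : ι → Module.Dual ℝ P),
      ∀ p j, T p (b j) = w j p • b j := by
  classical
  let core : InnerProductSpace.Core ℝ V :=
    { inner := fun x y => F x y
      conj_inner_symm := fun x y => hsymm y x
      re_inner_nonneg := fun x => by
        by_cases hx : x = 0
        · simp [hx]
        · exact (hpos x hx).le
      add_left := fun x y z => by simp
      smul_left := fun x y r => by simp
      definite := fun x hx => by
        by_contra h
        exact (hpos x h).ne' hx }
  let : NormedAddCommGroup V := core.toNormedAddCommGroup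
  let : InnerProductSpace ℝ V := InnerProductSpace.ofCore core.toCore
  have hsup := LinearMap.IsSymmetric.iSup_iInf_eq_top_of_commute (𝕜 := ℝ) (T := fun p => T p)
    (fun p x y => hT p x y) (fun p q _ => hcomm p q)
  let S : Set V := {v | ∃ χ : P → ℝ, ∀ p, T p v = χ p • v}
  have hspan : ⊤ ≤ Submodule.span ℝ S := by
    rw [← hsup]
    refine iSup_le fun χ v hv => Submodule.subset_span ⟨χ, fun p => ?_⟩
    exact Module.End.mem_eigenspace_iff.mp ((Submodule.mem_iInf _).mp hv p)
  -- The joint eigenvectors span, so a basis can be extracted from them; the eigenvalue is read off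
  -- as a coordinate, which makes it linear in the parameter.
  let b₀ := Module.Basis.ofSpan hspan
  have hfin : Fintype ((linearIndepOn_empty ℝ id).extend (Set.empty_subset S)) :=
    FiniteDimensional.fintypeBasisIndex b₀
  let b := b₀.reindex (Fintype.equivFin _)
  have hb : ∀ j, ∃ χ : P → ℝ, ∀ p, T p (b j) = χ p • b j := by
    intro j
    have : b j ∈ S := Module.Basis.ofSpan_subset hspan ⟨(Fintype.equivFin _).symm j, by simp [b, b₀]⟩
    exact this
  refine ⟨_, inferInstance, b, fun j => b.coord j ∘ₗ (LinearMap.applyₗ (b j)) ∘ₗ T, fun p j => ?_⟩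
  obtain ⟨χ, hχ⟩ := hb j
  simp [hχ]

variable {𝔤 : Type u} [LieRing 𝔤] [LieAlgebra ℝ 𝔤]

/-! ### The dual bracket attached to an involution -/

section Involution

/-- The adjoint action for the bracket of the dual symmetric Lie algebra: `ad T` if `θ T = T`,
and `ad T ∘ θ` if `θ T = -T`. -/
def dualAd (θ : 𝔤 ≃ₗ⁅ℝ⁆ 𝔤) : 𝔤 →ₗ[ℝ] Module.End ℝ 𝔤 :=
  LinearMap.mk₂ ℝ (fun T V => ⁅(2⁻¹ : ℝ) • (T + θ T), V⁆ + ⁅(2⁻¹ : ℝ) • (T - θ T), θ V⁆)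
    (fun S T V => by
      simp only [map_add, smul_add, smul_sub, add_lie, sub_lie]
      abel)
    (fun t T V => by
      simp only [map_smul, ← smul_add, ← smul_sub, smul_comm _ t, smul_lie])
    (fun T U V => by
      simp only [map_add, lie_add]
      abel)
    (fun t T V => by
      simp only [map_smul, lie_smul, smul_add])

variable {θ : 𝔤 ≃ₗ⁅ℝ⁆ 𝔤}

theorem dualAd_of_fixed {T : 𝔤} (hT : θ T = T) (V : 𝔤) : dualAd θ T V = ⁅T, V⁆ := by
  simp only [dualAd, LinearMap.mk₂_apply, hT, sub_self, smul_zero, zero_lie, add_zero,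
    ← two_smul ℝ T, smul_smul]
  norm_num

theorem dualAd_of_neg {T : 𝔤} (hT : θ T = -T) (V : 𝔤) : dualAd θ T V = ⁅T, θ V⁆ := by
  simp only [dualAd, LinearMap.mk₂_apply, hT, add_neg_cancel, smul_zero, zero_lie, zero_add,
    sub_neg_eq_add, ← two_smul ℝ T, smul_smul]
  norm_num

theorem exists_eq_add_of_involutive (hθ : ∀ X, θ (θ X) = X) (X : 𝔤) :
    ∃ S T, θ S = S ∧ θ T = -T ∧ X = S + T := by
  refine ⟨(2⁻¹ : ℝ) • (X + θ X), (2⁻¹ : ℝ) • (X - θ X), ?_, ?_, ?_⟩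
  · rw [map_smul, map_add, hθ, add_comm]
  · rw [map_smul, map_sub, hθ, ← smul_neg, neg_sub]
  · rw [← smul_add, add_add_sub_cancel, ← two_smul ℝ X, smul_smul]
    norm_num

/-- This is the Jacobi identity of the dual bracket, which differs from the original one by a sign
on pairs of `-1`-eigenvectors. By bilinearity it is checked on eigenvectors of `θ`. -/
theorem isBracketRep_dualAd (hθ : ∀ X, θ (θ X) = X) :
    IsBracketRep (dualAd θ) (dualAd θ) := by
  have kk : ∀ S S', θ S = S → θ S' = S' → ∀ V, dualAd θ (dualAd θ S S') V =
      dualAd θ S (dualAd θ S' V) - dualAd θ S' (dualAd θ S V) := by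
    intro S S' h h' V
    have h1 : θ ⁅S, S'⁆ = ⁅S, S'⁆ := by rw [LieEquiv.map_lie, h, h']
    simp only [dualAd_of_fixed h, dualAd_of_fixed h', dualAd_of_fixed h1, lie_lie]
  have km : ∀ S T, θ S = S → θ T = -T → ∀ V, dualAd θ (dualAd θ S T) V =
      dualAd θ S (dualAd θ T V) - dualAd θ T (dualAd θ S V) := by
    intro S T h h' V
    have h1 : θ ⁅S, T⁆ = -⁅S, T⁆ := by rw [LieEquiv.map_lie, h, h', lie_neg]
    simp only [dualAd_of_fixed h, dualAd_of_neg h', dualAd_of_neg h1, lie_lie, LieEquiv.map_lie, h]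
  have mm : ∀ T T', θ T = -T → θ T' = -T' → ∀ V, dualAd θ (dualAd θ T T') V =
      dualAd θ T (dualAd θ T' V) - dualAd θ T' (dualAd θ T V) := by
    intro T T' h h' V
    have h1 : θ ⁅T, T'⁆ = ⁅T, T'⁆ := by rw [LieEquiv.map_lie, h, h', lie_neg, neg_lie, neg_neg]
    have h2 : θ ⁅T, θ T'⁆ = ⁅T, θ T'⁆ := by rw [h', lie_neg, map_neg, h1]
    rw [dualAd_of_neg h, dualAd_of_fixed h2]
    simp only [dualAd_of_neg h, dualAd_of_neg h', LieEquiv.map_lie, h, h', hθ,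
      lie_neg, neg_lie, lie_lie]
    abel
  have mk : ∀ T S, θ T = -T → θ S = S → ∀ V, dualAd θ (dualAd θ T S) V =
      dualAd θ T (dualAd θ S V) - dualAd θ S (dualAd θ T V) := by
    intro T S h h' V
    have h1 : dualAd θ T S = -dualAd θ S T := by
      rw [dualAd_of_neg h, dualAd_of_fixed h', h', lie_skew]
    rw [h1, map_neg, LinearMap.neg_apply, km S T h' h, neg_sub]
  intro X X'
  ext V
  obtain ⟨S, T, hS, hT, rfl⟩ := exists_eq_add_of_involutive hθ X
  obtain ⟨S', T', hS', hT', rfl⟩ := exists_eq_add_of_involutive hθ X'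
  simp only [map_add, LinearMap.add_apply, LinearMap.sub_apply, Module.End.mul_apply,
    kk S S' hS hS', km S T' hS hT', mk T S' hT hS', mm T T' hT hT']
  abel

variable {m : Submodule ℝ 𝔤}

theorem fixed_of_mem_derived {n : Submodule ℝ 𝔤} (hn : ∀ X ∈ n, θ X = -X) {T : 𝔤}
    (hT : T ∈ derived n) : θ T = T := by
  induction hT using Submodule.span_induction with
  | mem T hT =>
    obtain ⟨U, hU, V, hV, rfl⟩ := hT
    rw [LieEquiv.map_lie, hn U hU, hn V hV, lie_neg, neg_lie, neg_neg]
  | zero => simp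
  | add S T _ _ hS hT => rw [map_add, hS, hT]
  | smul t T _ hT => rw [map_smul, hT]

theorem isLieTripleSystem_of_mem_iff (hm : ∀ X, X ∈ m ↔ θ X = -X) : IsLieTripleSystem m := by
  intro X hX Y hY Z hZ
  rw [hm] at *
  rw [LieEquiv.map_lie, LieEquiv.map_lie, hX, hY, hZ]
  simp

variable {c : ℝ}

/-- Elements of a Cartan subalgebra in the same Weyl orbit act by similar operators in all
representations of the dual bracket. -/
theorem isRepConj_of_mem_weylGroup [FiniteDimensional ℝ 𝔤]
    (hcompact : KillingNegDef 𝔤) (hc : 0 < c)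
    {n a : Submodule ℝ 𝔤} (hn : IsLieTripleSystem n) (hnθ : ∀ X ∈ n, θ X = -X) (ha : IsCartan n a)
    {w : a ≃ₗ[ℝ] a} (hw : w ∈ weylGroup c n a) (Z : a) :
    IsRepConj (dualAd θ) (Z : 𝔤) (w Z : 𝔤) := by
  induction hw using Subgroup.closure_induction generalizing Z with
  | mem R hR =>
    obtain ⟨α, hα, hR⟩ := hR
    obtain ⟨A, X, Y, h⟩ := exists_rootTriple hcompact hc hn ha hα
    -- Since `Y` is fixed by `θ`, `dualAd θ Y` is `ad Y`, so the same rotation exists for the dual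
    -- bracket.
    have hY := fixed_of_mem_derived hnθ h.mem_derived
    set t := α Z / α A with ht
    set U : a := Z - t • A with hU
    have key := isRepConj_of_rotation (D := dualAd θ) (y := Y) (A := t • (A : 𝔤)) (x := t • X)
      (z := U) h.pos one_pos
      (by rw [map_smul, dualAd_of_fixed hY, h.lie_swap, smul_comm])
      (by rw [map_smul, dualAd_of_fixed hY, h.lie_eq', one_smul, smul_neg])
      (by rw [dualAd_of_fixed hY, h.lie_swap, h.apply_sub, zero_smul])
    have e1 : t • (A : 𝔤) + (U : 𝔤) = Z := by
      rw [hU, Submodule.coe_sub, Submodule.coe_smul, add_sub_cancel]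
    have e2 : -(t • (A : 𝔤)) + (U : 𝔤) = R Z := by
      rw [hR.apply h]
      rfl
    rwa [e1, e2] at key
  | one => exact IsRepConj.refl _ _
  | mul w₁ w₂ _ _ h₁ h₂ => exact (h₂ Z).trans (h₁ (w₂ Z))
  | inv w _ h =>
    have := h (w⁻¹ Z)
    rw [← LinearEquiv.mul_apply, mul_inv_cancel] at this
    exact this.symm

/-- A joint eigenbasis for the dual action of a Cartan subalgebra. -/
theorem exists_weight_basis [FiniteDimensional ℝ 𝔤]
    (hcompact : KillingNegDef 𝔤) (hθ : ∀ X, θ (θ X) = X)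
    {a : Submodule ℝ 𝔤} (haθ : ∀ X ∈ a, θ X = -X) (ha : IsFlat a) :
    ∃ (ι : Type) (_ : Fintype ι) (b : Module.Basis ι ℝ 𝔤) (w : ι → Module.Dual ℝ a),
      ∀ (Z : a) j, dualAd θ (Z : 𝔤) (b j) = w j Z • b j := by
  refine exists_joint_eigenbasis (metric 𝔤 1) (metric_comm 1)
    (fun X hX => metric_pos hcompact one_pos hX) (dualAd θ ∘ₗ a.subtype) ?_ ?_
  · intro Z X Y
    have hZ := haθ Z Z.2
    have hinv : ∀ X Y : 𝔤, metric 𝔤 1 (θ X) (θ Y) = metric 𝔤 1 X Y := fun X Y => by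
      rw [metric_apply, metric_apply, LieAlgebra.killingForm_of_equiv_apply]
    simp only [LinearMap.comp_apply, Submodule.subtype_apply, dualAd_of_neg hZ]
    rw [← lie_skew, map_neg, LinearMap.neg_apply, metric_lie, ← hinv, hθ, LieEquiv.map_lie, hZ,
      neg_lie, map_neg, neg_neg]
  · intro Z Z'
    have hZ := haθ Z Z.2
    rw [← sub_eq_zero]
    simp only [LinearMap.comp_apply, Submodule.subtype_apply]
    rw [← isBracketRep_dualAd hθ, dualAd_of_neg hZ, haθ Z' Z'.2, lie_neg, ha _ Z.2 _ Z'.2]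
    simp

/-! ### Weights of the dual action and roots; finiteness of the Weyl group. -/

section Weights

variable {a : Submodule ℝ 𝔤} {ι : Type} {b : Module.Basis ι ℝ 𝔤} {w : ι → Module.Dual ℝ a}

/-- The `m`-part `b j - θ (b j)` of a weight vector is a root vector; if it vanished, the weight
would equal its own negative. -/
theorem weight_mem_roots (hθ : ∀ X, θ (θ X) = X) (hm : ∀ X, X ∈ m ↔ θ X = -X) (ham : a ≤ m)
    (hw : ∀ (Z : a) j, dualAd θ (Z : 𝔤) (b j) = w j Z • b j) {j : ι} (hj : w j ≠ 0) :
    w j ∈ roots m a := by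
  have h1 : ∀ Z : a, ⁅(Z : 𝔤), θ (b j)⁆ = w j Z • b j := fun Z => by
    rw [← hw, dualAd_of_neg ((hm _).mp (ham Z.2))]
  have h2 : ∀ Z : a, ⁅(Z : 𝔤), b j⁆ = -(w j Z • θ (b j)) := fun Z => by
    have := congrArg θ (h1 Z)
    rw [LieEquiv.map_lie, hθ, (hm _).mp (ham Z.2), map_smul, neg_lie] at this
    rw [← this, neg_neg]
  refine ⟨hj, (Submodule.ne_bot_iff _).mpr ⟨b j - θ (b j), ⟨?_, fun Z => ?_⟩, fun h0 => hj ?_⟩⟩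
  · rw [hm, map_sub, hθ, neg_sub]
  · simp only [lie_sub, h1, h2, lie_neg, lie_smul]
    module
  · ext Z
    have h3 := h1 Z
    rw [← sub_eq_zero.mp h0, h2, ← sub_eq_zero.mp h0] at h3
    have h4 : (2 * w j Z) • b j = 0 := by
      rw [two_mul, add_smul]
      nth_rewrite 1 [← h3]
      simp
    simpa using (smul_eq_zero.mp h4).resolve_right (b.ne_zero j)

/-- For a root triple, `X - Y` is a weight vector of weight `α`, and any basis vector occurring in
it has the same weight. -/
theorem roots_subset_range_weight [FiniteDimensional ℝ 𝔤]
    (hcompact : KillingNegDef 𝔤) (hm : ∀ X, X ∈ m ↔ θ X = -X)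
    (ha : IsCartan m a) (hw : ∀ (Z : a) j, dualAd θ (Z : 𝔤) (b j) = w j Z • b j)
    {α : Module.Dual ℝ a} (hα : α ∈ roots m a) : ∃ j, w j = α := by
  obtain ⟨A, X, Y, h⟩ := exists_rootTriple hcompact one_pos
    (isLieTripleSystem_of_mem_iff hm) ha hα
  have hX := (hm X).mp h.mem
  have hY := fixed_of_mem_derived (fun X hX => (hm X).mp hX) h.mem_derived
  have hZ : ∀ Z : a, dualAd θ (Z : 𝔤) (X - Y) = α Z • (X - Y) := fun Z => by
    rw [dualAd_of_neg ((hm _).mp (ha.1 Z.2)), map_sub, hX, hY, lie_sub, lie_neg, h.lie_left,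
      h.lie_right, smul_sub]
    abel
  have hne : X - Y ≠ 0 := by
    intro h0
    have hXY := sub_eq_zero.mp h0
    have h1 : (A : 𝔤) = 0 := by rw [← h.lie_eq, hXY, lie_self]
    have h2 := h.pos
    rw [Submodule.coe_eq_zero.mp h1, map_zero] at h2
    exact lt_irrefl _ h2
  obtain ⟨j, hj⟩ : ∃ j, b.coord j (X - Y) ≠ 0 := by
    by_contra! h0
    exact hne (b.forall_coord_eq_zero_iff.mp h0)
  refine ⟨j, ?_⟩
  ext Z
  have hcoord : ∀ V, b.coord j (dualAd θ (Z : 𝔤) V) = w j Z * b.coord j V := by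
    intro V
    have : b.coord j ∘ₗ dualAd θ (Z : 𝔤) = w j Z • b.coord j := by
      refine b.ext fun l => ?_
      by_cases hl : l = j
      · simp [hw, hl]
      · simp [hw, hl]
    exact LinearMap.congr_fun this V
  have h1 := hcoord (X - Y)
  rw [hZ, map_smul, smul_eq_mul] at h1
  exact (mul_right_cancel₀ hj h1).symm

/-- Weights separate points: if all vanish at `Z`, then `ad Z = 0`, and a definite Killing form
excludes a nonzero center. -/
theorem eq_zero_of_weight_eq_zero (hcompact : KillingNegDef 𝔤) (hθ : ∀ X, θ (θ X) = X)
    (haθ : ∀ X ∈ a, θ X = -X) (hw : ∀ (Z : a) j, dualAd θ (Z : 𝔤) (b j) = w j Z • b j) {Z : a}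
    (hZ : ∀ j, w j Z = 0) : Z = 0 := by
  have h1 : dualAd θ (Z : 𝔤) = 0 := b.ext fun j => by simp [hw, hZ]
  have h2 : LieAlgebra.ad ℝ 𝔤 (Z : 𝔤) = 0 := by
    ext V
    have := LinearMap.congr_fun h1 (θ V)
    rwa [dualAd_of_neg (haθ Z Z.2), hθ] at this
  by_contra hne
  have h3 := hcompact (Z : 𝔤) (by simpa using hne)
  rw [killingForm_apply_apply, h2] at h3
  simp at h3

/-- An element is determined by its action on the weights, which stay in a finite set. Zero is
adjoined to that set because it need not be a weight a priori and only nonzero weights are roots. -/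
theorem finite_weylGroup [FiniteDimensional ℝ 𝔤]
    (hcompact : KillingNegDef 𝔤) (hc : 0 < c) (hθ : ∀ X, θ (θ X) = X)
    (hm : ∀ X, X ∈ m ↔ θ X = -X) (ha : IsCartan m a) : Finite (weylGroup c m a) := by
  have haθ : ∀ X ∈ a, θ X = -X := fun X hX => (hm X).mp (ha.1 hX)
  obtain ⟨ι, _, b, w, hw⟩ := exists_weight_basis hcompact hθ haθ ha.2.1
  have hmem : ∀ (s : weylGroup c m a) (j : ι), w j ∘ₗ ((s : a ≃ₗ[ℝ] a) : a →ₗ[ℝ] a) ∈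
      insert 0 (Set.range w) := by
    intro s j
    by_cases hj : w j = 0
    · simp [hj]
    · have h1 := comp_inv_mem_roots hcompact hc (isLieTripleSystem_of_mem_iff hm) ha
        (inv_mem s.2) (weight_mem_roots hθ hm ha.1 hw hj)
      rw [inv_inv] at h1
      exact Or.inr (roots_subset_range_weight hcompact hm ha hw h1)
  have hfin : Finite (insert 0 (Set.range w) : Set (Module.Dual ℝ a)) :=
    ((Set.finite_range w).insert 0).to_subtype
  refine Finite.of_injective
    (fun (s : weylGroup c m a) (j : ι) => (⟨_, hmem s j⟩ : (insert 0 (Set.range w) : Set _))) ?_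
  intro s t hst
  refine Subtype.ext (LinearEquiv.ext fun Z => ?_)
  rw [← sub_eq_zero]
  refine eq_zero_of_weight_eq_zero hcompact hθ haθ hw fun j => ?_
  have h1 := congrArg Subtype.val (congrFun hst j)
  have h2 := LinearMap.congr_fun h1 Z
  rw [map_sub, sub_eq_zero]
  exact h2

end Weights

/-- Elements of a Cartan subalgebra that are similar in all representations of the dual bracket
lie in one Weyl orbit. -/
theorem exists_weylGroup_apply_eq [FiniteDimensional ℝ 𝔤]
    (hcompact : KillingNegDef 𝔤) (hc : 0 < c)
    (hθ : ∀ X, θ (θ X) = X) (hm : ∀ X, X ∈ m ↔ θ X = -X) {a : Submodule ℝ 𝔤} (ha : IsCartan m a)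
    {U V : a} (hUV : IsRepConj (dualAd θ) (U : 𝔤) (V : 𝔤)) :
    ∃ s ∈ weylGroup c m a, s V = U := by
  have haθ : ∀ X ∈ a, θ X = -X := fun X hX => (hm X).mp (ha.1 hX)
  have hmL := isLieTripleSystem_of_mem_iff hm
  obtain ⟨ι, _, b, w, hw⟩ := exists_weight_basis hcompact hθ haθ ha.2.1
  have := finite_weylGroup hcompact hc hθ hm ha
  obtain ⟨s, hs⟩ := Finite.exists_max fun s : weylGroup c m a =>
    metric 𝔤 c (U : 𝔤) ((s : a ≃ₗ[ℝ] a) V : 𝔤)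
  refine ⟨s, s.2, ?_⟩
  set V' : a := (s : a ≃ₗ[ℝ] a) V with hV'
  have hconj : IsRepConj (dualAd θ) (U : 𝔤) (V' : 𝔤) :=
    hUV.trans (isRepConj_of_mem_weylGroup hcompact hc hmL (fun X hX => (hm X).mp hX) ha s.2 V)
  -- If the weight were positive on `U` and negative on `V'`, reflecting `V'` in it would increase
  -- the inner product with `U`, against the choice of `s`.
  have hsign : ∀ j, 0 < w j U → 0 ≤ w j V' := by
    intro j hj
    by_contra! hneg
    have hroot := weight_mem_roots hθ hm ha.1 hw (j := j) fun h0 => by simp [h0] at hj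
    obtain ⟨A, X, Y, h⟩ := exists_rootTriple hcompact hc hmL ha hroot
    obtain ⟨R, hR⟩ := h.exists_reflection hcompact hc
    have hmax := hs (⟨R, Subgroup.subset_closure ⟨_, hroot, hR⟩⟩ * s)
    obtain ⟨r, hr, hmetric⟩ := h.metric_eq
    have e : ((R V' : a) : 𝔤) = (V' : 𝔤) - (2 * (w j V' / w j A)) • (A : 𝔤) := by
      rw [hR.apply h, two_mul, add_smul]
      simp only [Submodule.coe_add, Submodule.coe_neg, Submodule.coe_sub, Submodule.coe_smul]
      abel
    have hmax' : metric 𝔤 c (U : 𝔤) (R V' : 𝔤) ≤ metric 𝔤 c (U : 𝔤) (V' : 𝔤) := hmax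
    rw [e, map_sub, map_smul, hmetric, smul_eq_mul] at hmax'
    have h1 : w j V' / w j A < 0 := div_neg_of_neg_of_pos hneg h.pos
    have h2 : 0 < r * w j U := mul_pos hr hj
    nlinarith [mul_pos_of_neg_of_neg h1 (neg_neg_of_pos h2)]
  have hweight := weight_eq_of_isRepConj (isBracketRep_dualAd hθ) b (hw U) (hw V') hsign hconj
  rw [← sub_eq_zero]
  refine eq_zero_of_weight_eq_zero hcompact hθ haθ hw fun j => ?_
  rw [map_sub, hweight j, sub_self]

/-- The Weyl group of a Lie triple subsystem is induced by the ambient Weyl group. -/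
theorem exists_weylGroup_extension [FiniteDimensional ℝ 𝔤]
    (hcompact : KillingNegDef 𝔤) (hc : 0 < c)
    (hθ : ∀ X, θ (θ X) = X) (hm : ∀ X, X ∈ m ↔ θ X = -X) {n a a' : Submodule ℝ 𝔤}
    (hnm : n ≤ m) (hn : IsLieTripleSystem n) (ha : IsCartan m a) (ha' : IsCartan n a')
    (haa' : a' ≤ a) {w' : a' ≃ₗ[ℝ] a'} (hw' : w' ∈ weylGroup c n a') :
    ∃ w ∈ weylGroup c m a, ∀ Z : a', (w (Submodule.inclusion haa' Z) : 𝔤) = w' Z := by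
  have := finite_weylGroup hcompact hc hθ hm ha
  -- `p s` is the set of `Z` with `s (w' Z) = Z`. These finitely many subspaces cover `a'`, so one
  -- of them is all of `a'`.
  let p : weylGroup c m a → Submodule ℝ a' := fun s =>
    LinearMap.eqLocus (((s : a ≃ₗ[ℝ] a) : a →ₗ[ℝ] a) ∘ₗ Submodule.inclusion haa' ∘ₗ
      (w' : a' →ₗ[ℝ] a')) (Submodule.inclusion haa')
  have hcover : ⋃ s, (p s : Set a') = Set.univ := by
    refine Set.eq_univ_of_forall fun Z => Set.mem_iUnion.mpr ?_
    obtain ⟨s, hs, h⟩ := exists_weylGroup_apply_eq hcompact hc hθ hm ha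
      (U := Submodule.inclusion haa' Z) (V := Submodule.inclusion haa' (w' Z))
      (isRepConj_of_mem_weylGroup hcompact hc hn (fun X hX => (hm X).mp (hnm hX)) ha' hw' Z)
    exact ⟨⟨s, hs⟩, h⟩
  obtain ⟨s, hs⟩ := Subspace.exists_eq_top_of_iUnion_eq_univ hcover
  refine ⟨(s : a ≃ₗ[ℝ] a)⁻¹, inv_mem s.2, fun Z => ?_⟩
  have h : (s : a ≃ₗ[ℝ] a) (Submodule.inclusion haa' (w' Z)) = Submodule.inclusion haa' Z := by
    have : Z ∈ p s := by rw [hs]; trivial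
    exact this
  rw [← h, ← LinearEquiv.mul_apply, inv_mul_cancel]
  rfl

/-- Orthogonal projections onto subspaces exist. -/
theorem exists_isOrthogonalProjection [FiniteDimensional ℝ 𝔤]
    (hcompact : KillingNegDef 𝔤)
    (hc : 0 < c) {a a' : Submodule ℝ 𝔤} (haa' : a' ≤ a) :
    ∃ P : a →ₗ[ℝ] a, IsOrthogonalProjection c a a' P ∧ ∀ Z : a, (Z : 𝔤) ∈ a' → P Z = Z := by
  have hrefl : (metric 𝔤 c).IsRefl := fun X Y h => by rw [metric_comm, h]
  have hcompl : IsCompl a' ((metric 𝔤 c).orthogonal a') := by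
    refine (LinearMap.BilinForm.isCompl_orthogonal_iff_disjoint hrefl).mpr ?_
    refine Submodule.disjoint_def.mpr fun X hX hX' => ?_
    exact metric_self_eq_zero hcompact hc (hX' X hX)
  let P : a →ₗ[ℝ] a :=
    Submodule.inclusion haa' ∘ₗ Submodule.projectionOnto _ _ hcompl ∘ₗ a.subtype
  refine ⟨P, ⟨fun Z => (Submodule.projectionOnto _ _ hcompl (Z : 𝔤)).2, fun Z Y hY => ?_⟩,
    fun Z hZ => ?_⟩
  · have h1 : (Z : 𝔤) - (P Z : 𝔤) ∈ (metric 𝔤 c).orthogonal a' := by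
      rw [← Submodule.projectionOnto_apply_eq_zero_iff hcompl, map_sub, sub_eq_zero]
      exact (Submodule.projectionOnto_apply_left hcompl _).symm
    exact h1 Y hY
  · refine Subtype.ext ?_
    exact congrArg (fun X : a' => (X : 𝔤)) (Submodule.projectionOnto_apply_left hcompl ⟨Z, hZ⟩)

end Involution

end LieTriple

/-! ### One-parameter subgroups and the differential of the involution. -/

namespace LieTriple

variable {E : Type*} [NormedAddCommGroup E] [NormedSpace ℝ E]
  {G : Type*} [TopologicalSpace G] [ChartedSpace E G]

theorem vectorField_congr_base {V : Π g : G, TangentSpace 𝓘(ℝ, E) g} {g h : G} (e : g = h) :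
    (V g : E) = (V h : E) := by
  subst e; rfl

variable [Group G]

theorem isExp_smul {X : GroupLieAlgebra 𝓘(ℝ, E) G} {γ : ℝ → G} (h0 : γ 0 = 1)
    (hγ : IsMIntegralCurve (I := 𝓘(ℝ, E)) γ (mulInvariantVectorField X)) (t : ℝ) :
    IsExp (t • X) (γ t) := by
  refine ⟨γ ∘ (· * t), by simp [h0], ?_, by simp⟩
  rw [mulInvariantVectorField_smul]
  exact hγ.comp_mul t

theorem derivOne_derivOne {σ : G →* G}
    (hσ : ContMDiff 𝓘(ℝ, E) 𝓘(ℝ, E) ∞ (fun x : G => σ x))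
    (hinv : ∀ g, σ (σ g) = g) (X : GroupLieAlgebra 𝓘(ℝ, E) G) :
    derivOne (E := E) σ (derivOne (E := E) σ X) = X := by
  have hd : MDifferentiable 𝓘(ℝ, E) 𝓘(ℝ, E) (fun x : G => σ x) := hσ.mdifferentiable (by simp)
  have e : (fun x : G => σ x) ∘ (fun x : G => σ x) = id := by
    ext x; simp [hinv]
  have h1 := mfderiv_comp_apply_of_eq (I := 𝓘(ℝ, E)) (I' := 𝓘(ℝ, E)) (I'' := 𝓘(ℝ, E))
    (x := (1 : G)) (hd 1) (hd 1) (map_one σ) X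
  rw [e, mfderiv_id] at h1
  exact h1.symm

theorem isInvertible_mfderiv_of_involutive {σ : G →* G}
    (hσ : ContMDiff 𝓘(ℝ, E) 𝓘(ℝ, E) ∞ (fun x : G => σ x)) (hinv : ∀ g, σ (σ g) = g) (g : G) :
    (mfderiv 𝓘(ℝ, E) 𝓘(ℝ, E) (fun x : G => σ x) g).IsInvertible := by
  have hd : MDifferentiable 𝓘(ℝ, E) 𝓘(ℝ, E) (fun x : G => σ x) := hσ.mdifferentiable (by simp)
  have e : (fun x : G => σ x) ∘ (fun x : G => σ x) = id := by
    ext x; simp [hinv]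
  have h1 := mfderiv_comp (I := 𝓘(ℝ, E)) (I' := 𝓘(ℝ, E)) (I'' := 𝓘(ℝ, E)) g (hd (σ g)) (hd g)
  rw [e, mfderiv_id] at h1
  refine ContinuousLinearMap.IsInvertible.of_inverse (ContinuousLinearMap.ext fun X => ?_) h1.symm
  have h2 := mfderiv_comp_apply_of_eq (I := 𝓘(ℝ, E)) (I' := 𝓘(ℝ, E)) (I'' := 𝓘(ℝ, E))
    (x := σ g) (hd g) (hd (σ g)) (hinv g) X
  rw [e, mfderiv_id] at h2
  exact h2.symm

variable [LieGroup 𝓘(ℝ, E) ∞ G]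

/-! ### Integral curves of left-invariant vector fields -/

theorem mdifferentiable_mul_left (g : G) :
    MDifferentiable 𝓘(ℝ, E) 𝓘(ℝ, E) (fun x : G => g * x) :=
  (contMDiff_mul_left (I := 𝓘(ℝ, E)) (n := ∞)).mdifferentiable (by simp)

theorem mdifferentiable_mul_right (g : G) :
    MDifferentiable 𝓘(ℝ, E) 𝓘(ℝ, E) (fun x : G => x * g) :=
  (contMDiff_mul_right (I := 𝓘(ℝ, E)) (n := ∞)).mdifferentiable (by simp)

theorem mdifferentiable_conj (g : G) :
    MDifferentiable 𝓘(ℝ, E) 𝓘(ℝ, E) (fun x : G => g * x * g⁻¹) :=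
  (mdifferentiable_mul_right g⁻¹).comp (mdifferentiable_mul_left g)

theorem contMDiff_one_mulInvariantVectorField (X : GroupLieAlgebra 𝓘(ℝ, E) G) :
    ContMDiff 𝓘(ℝ, E) (𝓘(ℝ, E).prod 𝓘(ℝ, E)) 1
      (fun g : G => (⟨g, mulInvariantVectorField X g⟩ : TangentBundle 𝓘(ℝ, E) G)) := by
  refine (contMDiff_mulInvariantVectorField X).of_le ?_
  rw [minSmoothness_of_isRCLikeNormedField]
  norm_num

theorem mfderiv_mul_left_mulInvariantVectorField (X : GroupLieAlgebra 𝓘(ℝ, E) G) (g h : G) :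
    mfderiv 𝓘(ℝ, E) 𝓘(ℝ, E) (fun x : G => g * x) h (mulInvariantVectorField X h)
      = mulInvariantVectorField X (g * h) := by
  have e : (fun x : G => g * h * x) = (fun x => g * x) ∘ (fun x => h * x) := by
    ext x; simp [mul_assoc]
  have h1 := mfderiv_comp_apply_of_eq (I := 𝓘(ℝ, E)) (I' := 𝓘(ℝ, E)) (I'' := 𝓘(ℝ, E))
    (x := (1 : G)) (mdifferentiable_mul_left (E := E) g h) (mdifferentiable_mul_left (E := E) h 1)
    (mul_one h) X
  rw [← e] at h1
  exact h1.symm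

theorem isMIntegralCurve_mul_left {X : GroupLieAlgebra 𝓘(ℝ, E) G} {γ : ℝ → G}
    (hγ : IsMIntegralCurve (I := 𝓘(ℝ, E)) γ (mulInvariantVectorField X)) (g : G) :
    IsMIntegralCurve (I := 𝓘(ℝ, E)) (fun t => g * γ t) (mulInvariantVectorField X) := by
  intro t
  have h := (mdifferentiable_mul_left (E := E) g (γ t)).hasMFDerivAt.comp t (hγ t)
  refine h.congr_mfderiv ?_
  rw [← mfderiv_mul_left_mulInvariantVectorField]
  ext
  exact map_smul (mfderiv 𝓘(ℝ, E) 𝓘(ℝ, E) (fun x : G => g * x) (γ t)) (1 : ℝ)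
    (mulInvariantVectorField X (γ t))

/-- Left-invariant vector fields are complete. -/
theorem exists_isMIntegralCurve_one [CompleteSpace E] [T2Space G]
    (X : GroupLieAlgebra 𝓘(ℝ, E) G) :
    ∃ γ : ℝ → G, γ 0 = 1 ∧ IsMIntegralCurve (I := 𝓘(ℝ, E)) γ (mulInvariantVectorField X) := by
  have hv := contMDiff_one_mulInvariantVectorField (E := E) X
  obtain ⟨γ, hγ0, hγ⟩ := exists_isMIntegralCurveAt_of_contMDiffAt_boundaryless (I := 𝓘(ℝ, E))
    (t₀ := 0) (hv.contMDiffAt (x := 1))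
  obtain ⟨ε, hε, hγ⟩ := isMIntegralCurveAt_iff'.mp hγ
  rw [Real.ball_eq_Ioo, zero_sub, zero_add] at hγ
  -- Left translation gives the same existence time `ε` at every point, so local solutions extend to
  -- all times.
  refine exists_isMIntegralCurve_of_isMIntegralCurveOn hv hε (fun g => ⟨fun t => g * γ t, ?_, ?_⟩) 1
  · simp [hγ0]
  · intro t ht
    have h := (mdifferentiable_mul_left (E := E) g (γ t)).hasMFDerivAt.comp_hasMFDerivWithinAt t
      (hγ t ht)
    refine h.congr_mfderiv ?_
    rw [← mfderiv_mul_left_mulInvariantVectorField]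
    ext
    exact map_smul (mfderiv 𝓘(ℝ, E) 𝓘(ℝ, E) (fun x : G => g * x) (γ t)) (1 : ℝ)
      (mulInvariantVectorField X (γ t))

section OneParameter

variable {X : GroupLieAlgebra 𝓘(ℝ, E) G} {γ : ℝ → G}

theorem IsMIntegralCurve.eq_of_zero [CompleteSpace E] [T2Space G]
    {γ' : ℝ → G}
    (hγ : IsMIntegralCurve (I := 𝓘(ℝ, E)) γ (mulInvariantVectorField X))
    (hγ' : IsMIntegralCurve (I := 𝓘(ℝ, E)) γ' (mulInvariantVectorField X)) (h : γ 0 = γ' 0) :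
    γ = γ' :=
  isMIntegralCurve_Ioo_eq_of_contMDiff_boundaryless (contMDiff_one_mulInvariantVectorField X)
    hγ hγ' h

/-- Integral curves of left-invariant vector fields are one-parameter subgroups. -/
theorem IsMIntegralCurve.map_add [CompleteSpace E] [T2Space G] (h0 : γ 0 = 1)
    (hγ : IsMIntegralCurve (I := 𝓘(ℝ, E)) γ (mulInvariantVectorField X)) (s t : ℝ) :
    γ (s + t) = γ s * γ t := by
  have h := IsMIntegralCurve.eq_of_zero (hγ.comp_add s) (isMIntegralCurve_mul_left hγ (γ s))
    (by simp [h0])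
  have := congrFun h t
  simpa [add_comm] using this

end OneParameter

/-! ### Involutions -/

section Involution

variable {σ : G →* G}

theorem mfderiv_mulInvariantVectorField
    (hσ : ContMDiff 𝓘(ℝ, E) 𝓘(ℝ, E) ∞ (fun x : G => σ x)) (X : GroupLieAlgebra 𝓘(ℝ, E) G) (g : G) :
    mfderiv 𝓘(ℝ, E) 𝓘(ℝ, E) (fun x : G => σ x) g (mulInvariantVectorField X g)
      = mulInvariantVectorField (derivOne (E := E) σ X) (σ g) := by
  have hd : MDifferentiable 𝓘(ℝ, E) 𝓘(ℝ, E) (fun x : G => σ x) := hσ.mdifferentiable (by simp)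
  have e : (fun x : G => σ x) ∘ (fun x => g * x) = (fun x => σ g * x) ∘ (fun x : G => σ x) := by
    ext x; simp
  have h1 := mfderiv_comp_apply_of_eq (I := 𝓘(ℝ, E)) (I' := 𝓘(ℝ, E)) (I'' := 𝓘(ℝ, E))
    (x := (1 : G)) (hd g) (mdifferentiable_mul_left (E := E) g 1) (mul_one g) X
  have h2 := mfderiv_comp_apply_of_eq (I := 𝓘(ℝ, E)) (I' := 𝓘(ℝ, E)) (I'' := 𝓘(ℝ, E))
    (x := (1 : G)) (mdifferentiable_mul_left (E := E) (σ g) 1) (hd 1) (map_one σ) X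
  rw [e] at h1
  exact h1.symm.trans h2

/-- Pulling back by `σ` takes the left-invariant field of `dσ X` to that of `X`, and pullback
respects brackets of vector fields. Involutivity makes the differentials invertible. -/
theorem derivOne_lie [CompleteSpace E] (hσ : ContMDiff 𝓘(ℝ, E) 𝓘(ℝ, E) ∞ (fun x : G => σ x))
    (hinv : ∀ g, σ (σ g) = g) (X Y : GroupLieAlgebra 𝓘(ℝ, E) G) :
    derivOne (E := E) σ ⁅X, Y⁆ = ⁅derivOne (E := E) σ X, derivOne (E := E) σ Y⁆ := by
  have hpull : ∀ X : GroupLieAlgebra 𝓘(ℝ, E) G, VectorField.mpullback 𝓘(ℝ, E) 𝓘(ℝ, E)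
      (fun x : G => σ x) (mulInvariantVectorField (derivOne (E := E) σ X))
        = mulInvariantVectorField X := by
    intro X
    ext g
    rw [VectorField.mpullback_apply, ← mfderiv_mulInvariantVectorField hσ,
      (isInvertible_mfderiv_of_involutive hσ hinv g).inverse_apply_eq]
  have h := VectorField.mpullback_mlieBracket (I := 𝓘(ℝ, E)) (I' := 𝓘(ℝ, E)) (n := ∞)
    (f := fun x : G => σ x) (x₀ := 1)
    (mdifferentiableAt_mulInvariantVectorField (derivOne (E := E) σ X))
    (mdifferentiableAt_mulInvariantVectorField (derivOne (E := E) σ Y)) (hσ.contMDiffAt)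
    (by rw [minSmoothness_of_isRCLikeNormedField]; exact ENat.LEInfty.out)
  rw [hpull, hpull, VectorField.mpullback_apply,
    (isInvertible_mfderiv_of_involutive hσ hinv 1).inverse_apply_eq] at h
  rw [GroupLieAlgebra.bracket_def, GroupLieAlgebra.bracket_def]
  refine h.symm.trans ?_
  exact vectorField_congr_base (map_one σ)

/-- The differential of an involutive automorphism as an automorphism of the Lie algebra. -/
def derivEquiv [CompleteSpace E] (hσ : ContMDiff 𝓘(ℝ, E) 𝓘(ℝ, E) ∞ (fun x : G => σ x))
    (hinv : ∀ g, σ (σ g) = g) :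
    GroupLieAlgebra 𝓘(ℝ, E) G ≃ₗ⁅ℝ⁆ GroupLieAlgebra 𝓘(ℝ, E) G :=
  { (derivOne (E := E) σ : GroupLieAlgebra 𝓘(ℝ, E) G →ₗ[ℝ] GroupLieAlgebra 𝓘(ℝ, E) G) with
    map_lie' := fun {X Y} => derivOne_lie hσ hinv X Y
    invFun := derivOne (E := E) σ
    left_inv := derivOne_derivOne hσ hinv
    right_inv := derivOne_derivOne hσ hinv }

/-- The exponential of a fixed vector lies in the identity component of the fixed group. -/
theorem mem_of_isExp [CompleteSpace E] [T2Space G] {K : Subgroup G}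
    (hK : IsSymmetricPair E σ K) {X : GroupLieAlgebra 𝓘(ℝ, E) G}
    (hX : derivOne (E := E) σ X = X) {g : G} (hg : IsExp X g) : g ∈ K := by
  obtain ⟨γ, h0, hγ, rfl⟩ := hg
  have hd : MDifferentiable 𝓘(ℝ, E) 𝓘(ℝ, E) (fun x : G => σ x) :=
    hK.smooth.mdifferentiable (by simp)
  have hσγ : IsMIntegralCurve (I := 𝓘(ℝ, E)) (fun t => σ (γ t)) (mulInvariantVectorField X) := by
    intro t
    have h := (hd (γ t)).hasMFDerivAt.comp t (hγ t)
    refine h.congr_mfderiv ?_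
    have e := mfderiv_mulInvariantVectorField hK.smooth X (γ t)
    rw [hX] at e
    rw [← e]
    ext
    exact map_smul (mfderiv 𝓘(ℝ, E) 𝓘(ℝ, E) (fun x : G => σ x) (γ t)) (1 : ℝ)
      (mulInvariantVectorField X (γ t))
  -- By uniqueness `σ ∘ γ = γ`, so the range of `γ` is a connected subset of the fixed group
  -- containing `1`.
  have hfix := IsMIntegralCurve.eq_of_zero hσγ hγ (by simp [h0])
  refine hK.identityComponent_le _ ?_
  have hcon : IsPreconnected (Set.range γ) := isPreconnected_range hγ.continuous
  refine hcon.subset_connectedComponentIn ⟨0, h0⟩ ?_ ⟨1, rfl⟩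
  rintro _ ⟨t, rfl⟩
  exact congrFun hfix t

end Involution

end LieTriple

namespace LieTriple

variable {E : Type*} [NormedAddCommGroup E] [NormedSpace ℝ E]
  {G : Type*} [TopologicalSpace G] [ChartedSpace E G] [Group G]

/-! ### The product in the chart at the identity -/

/-- The product of the group, read in the preferred chart at `1`. -/
def chartMul (E G : Type*) [NormedAddCommGroup E] [NormedSpace ℝ E] [TopologicalSpace G]
    [ChartedSpace E G] [Group G] (p : E × E) : E :=
  extChartAt 𝓘(ℝ, E) (1 : G) ((extChartAt 𝓘(ℝ, E) (1 : G)).symm p.1 *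
    (extChartAt 𝓘(ℝ, E) (1 : G)).symm p.2)

/-- The coordinates of the identity in the preferred chart at `1`. -/
def chartOne (E G : Type*) [NormedAddCommGroup E] [NormedSpace ℝ E] [TopologicalSpace G]
    [ChartedSpace E G] [Group G] : E :=
  extChartAt 𝓘(ℝ, E) (1 : G) 1

theorem chart_symm_chartOne : (extChartAt 𝓘(ℝ, E) (1 : G)).symm (chartOne E G) = 1 :=
  extChartAt_to_inv _

variable [LieGroup 𝓘(ℝ, E) ∞ G]

theorem contDiffAt_chartMul : ContDiffAt ℝ ∞ (chartMul E G) (chartOne E G, chartOne E G) := by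
  have hsymm : ContMDiffAt 𝓘(ℝ, E) 𝓘(ℝ, E) ∞ (extChartAt 𝓘(ℝ, E) (1 : G)).symm (chartOne E G) :=
    (contMDiffOn_extChartAt_symm (1 : G)).contMDiffAt
      (extChartAt_target_mem_nhds (I := 𝓘(ℝ, E)) (1 : G))
  have h1 : ContMDiffAt 𝓘(ℝ, E × E) 𝓘(ℝ, E) ∞
      (fun p : E × E => (extChartAt 𝓘(ℝ, E) (1 : G)).symm p.1) (chartOne E G, chartOne E G) :=
    ContMDiffAt.comp (x := (chartOne E G, chartOne E G)) (f := Prod.fst) hsymm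
      contDiffAt_fst.contMDiffAt
  have h2 : ContMDiffAt 𝓘(ℝ, E × E) 𝓘(ℝ, E) ∞
      (fun p : E × E => (extChartAt 𝓘(ℝ, E) (1 : G)).symm p.2) (chartOne E G, chartOne E G) :=
    ContMDiffAt.comp (x := (chartOne E G, chartOne E G)) (f := Prod.snd) hsymm
      contDiffAt_snd.contMDiffAt
  have h3 := h1.mul h2
  have h4 : ContMDiffAt 𝓘(ℝ, E) 𝓘(ℝ, E) ∞ (extChartAt 𝓘(ℝ, E) (1 : G))
      ((extChartAt 𝓘(ℝ, E) (1 : G)).symm (chartOne E G) *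
        (extChartAt 𝓘(ℝ, E) (1 : G)).symm (chartOne E G)) := by
    rw [chart_symm_chartOne, one_mul]
    exact contMDiffAt_extChartAt
  exact (ContMDiffAt.comp (x := (chartOne E G, chartOne E G)) h4 h3).contDiffAt

theorem mdifferentiableAt_chart_symm_chartOne :
    MDifferentiableAt 𝓘(ℝ, E) 𝓘(ℝ, E) (extChartAt 𝓘(ℝ, E) (1 : G)).symm (chartOne E G) :=
  ((contMDiffOn_extChartAt_symm (n := ∞) (1 : G)).contMDiffAt
      (extChartAt_target_mem_nhds (I := 𝓘(ℝ, E)) (1 : G))).mdifferentiableAt (by simp)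

theorem mfderiv_chart_symm_chartOne (v : E) :
    (mfderiv 𝓘(ℝ, E) 𝓘(ℝ, E) (extChartAt 𝓘(ℝ, E) (1 : G)).symm (chartOne E G) v : E) = v := by
  have h := mfderivWithin_range_extChartAt_symm (I := 𝓘(ℝ, E)) (x := (1 : G))
  rw [modelWithCornersSelf_coe, Set.range_id, mfderivWithin_univ] at h
  exact DFunLike.congr_fun h v

theorem mdifferentiableAt_chart {g : G} (hg : g ∈ (extChartAt 𝓘(ℝ, E) (1 : G)).source) :
    MDifferentiableAt 𝓘(ℝ, E) 𝓘(ℝ, E) (extChartAt 𝓘(ℝ, E) (1 : G)) g :=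
  mdifferentiableAt_extChartAt (by rwa [← extChartAt_source (I := 𝓘(ℝ, E))])

/-- The derivative of a map in coordinates that are centered at `1` in the source. -/
theorem differentiableAt_chart_comp_and_fderiv_eq {f : G → G} (hf : MDifferentiableAt 𝓘(ℝ, E) 𝓘(ℝ, E) f 1)
    (hf1 : f 1 ∈ (extChartAt 𝓘(ℝ, E) (1 : G)).source) :
    DifferentiableAt ℝ (fun y : E => extChartAt 𝓘(ℝ, E) (1 : G)
      (f ((extChartAt 𝓘(ℝ, E) (1 : G)).symm y))) (chartOne E G) ∧
    ∀ v : E, fderiv ℝ (fun y : E => extChartAt 𝓘(ℝ, E) (1 : G)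
      (f ((extChartAt 𝓘(ℝ, E) (1 : G)).symm y))) (chartOne E G) v =
      mfderiv 𝓘(ℝ, E) 𝓘(ℝ, E) (extChartAt 𝓘(ℝ, E) (1 : G)) (f 1)
        (mfderiv 𝓘(ℝ, E) 𝓘(ℝ, E) f 1 v) := by
  have h1 := mdifferentiableAt_chart_symm_chartOne (E := E) (G := G)
  have h2 := MDifferentiableAt.comp_of_eq _ hf h1 chart_symm_chartOne
  have e2 : (f ∘ (extChartAt 𝓘(ℝ, E) (1 : G)).symm) (chartOne E G) = f 1 := by
    rw [Function.comp_apply, chart_symm_chartOne]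
  have h3 := MDifferentiableAt.comp_of_eq _ (mdifferentiableAt_chart hf1) h2 e2
  refine ⟨mdifferentiableAt_iff_differentiableAt.mp h3, fun v => ?_⟩
  have d2 := mfderiv_comp_apply_of_eq _ hf h1 chart_symm_chartOne v
  have d3 := mfderiv_comp_apply_of_eq _ (mdifferentiableAt_chart hf1) h2 e2 v
  rw [d2, mfderiv_eq_fderiv] at d3
  refine d3.trans ?_
  congr 2
  exact mfderiv_chart_symm_chartOne v

end LieTriple

/-! ### Translations, the adjoint action and the bracket in the chart. -/

namespace LieTriple

variable {E : Type*} [NormedAddCommGroup E] [NormedSpace ℝ E]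
  {G : Type*} [TopologicalSpace G] [ChartedSpace E G] [Group G]

theorem mulInvariantVectorField_one (X : GroupLieAlgebra 𝓘(ℝ, E) G) :
    (mulInvariantVectorField X (1 : G) : E) = X := by
  have e : (fun x : G => 1 * x) = id := by ext x; simp
  have h : mfderiv 𝓘(ℝ, E) 𝓘(ℝ, E) (fun x : G => 1 * x) 1 X = (X : E) := by
    rw [e, mfderiv_id]; rfl
  exact h

theorem mfderiv_chart_congr_base {g g' : G} (h : g' = g) (w : E) :
    (mfderiv 𝓘(ℝ, E) 𝓘(ℝ, E) (extChartAt 𝓘(ℝ, E) (1 : G)) g' w : E) =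
      mfderiv 𝓘(ℝ, E) 𝓘(ℝ, E) (extChartAt 𝓘(ℝ, E) (1 : G)) g w := by
  subst h; rfl

theorem Ad_one (Y : GroupLieAlgebra 𝓘(ℝ, E) G) : Ad (E := E) (1 : G) Y = Y := by
  have e : (fun x : G => 1 * x * 1⁻¹) = id := by ext x; simp
  have h : mfderiv 𝓘(ℝ, E) 𝓘(ℝ, E) (fun x : G => 1 * x * 1⁻¹) 1 Y = (Y : E) := by
    rw [e, mfderiv_id]; rfl
  exact h

variable [LieGroup 𝓘(ℝ, E) ∞ G]

theorem fderiv_chartMul_inr {x : E} (hx : x ∈ (extChartAt 𝓘(ℝ, E) (1 : G)).target)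
    (hd : DifferentiableAt ℝ (chartMul E G) (x, chartOne E G)) (v : GroupLieAlgebra 𝓘(ℝ, E) G) :
    fderiv ℝ (chartMul E G) (x, chartOne E G) ((0 : E), (v : E)) =
      mfderiv 𝓘(ℝ, E) 𝓘(ℝ, E) (extChartAt 𝓘(ℝ, E) (1 : G))
        ((extChartAt 𝓘(ℝ, E) (1 : G)).symm x)
        (mulInvariantVectorField v ((extChartAt 𝓘(ℝ, E) (1 : G)).symm x)) := by
  set g : G := (extChartAt 𝓘(ℝ, E) (1 : G)).symm x with hg
  have hgs : g ∈ (extChartAt 𝓘(ℝ, E) (1 : G)).source := (extChartAt 𝓘(ℝ, E) (1 : G)).map_target hx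
  have h := (differentiableAt_chart_comp_and_fderiv_eq (mdifferentiable_mul_left (E := E) g 1)
    (by simpa using hgs)).2 v
  have e : fderiv ℝ (chartMul E G ∘ fun y : E => (x, y)) (chartOne E G) v =
      fderiv ℝ (chartMul E G) (x, chartOne E G) ((0 : E), (v : E)) := by
    have hp := hasFDerivAt_prodMk_right (𝕜 := ℝ) x (chartOne E G)
    rw [(hd.hasFDerivAt.comp (chartOne E G) hp).fderiv]
    rfl
  rw [← e]
  refine h.trans ?_
  exact mfderiv_chart_congr_base (mul_one g) _

theorem fderiv_chartMul_inl {x : E} (hx : x ∈ (extChartAt 𝓘(ℝ, E) (1 : G)).target)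
    (hd : DifferentiableAt ℝ (chartMul E G) (chartOne E G, x)) (v : GroupLieAlgebra 𝓘(ℝ, E) G) :
    fderiv ℝ (chartMul E G) (chartOne E G, x) ((v : E), (0 : E)) =
      mfderiv 𝓘(ℝ, E) 𝓘(ℝ, E) (extChartAt 𝓘(ℝ, E) (1 : G))
        ((extChartAt 𝓘(ℝ, E) (1 : G)).symm x)
        (mfderiv 𝓘(ℝ, E) 𝓘(ℝ, E) (fun y : G => y * (extChartAt 𝓘(ℝ, E) (1 : G)).symm x) 1 v : E) := by
  set g : G := (extChartAt 𝓘(ℝ, E) (1 : G)).symm x with hg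
  have hgs : g ∈ (extChartAt 𝓘(ℝ, E) (1 : G)).source := (extChartAt 𝓘(ℝ, E) (1 : G)).map_target hx
  have h := (differentiableAt_chart_comp_and_fderiv_eq (mdifferentiable_mul_right (E := E) g 1)
    (by simpa using hgs)).2 v
  have e : fderiv ℝ (chartMul E G ∘ fun y : E => (y, x)) (chartOne E G) v =
      fderiv ℝ (chartMul E G) (chartOne E G, x) ((v : E), (0 : E)) := by
    have hp := hasFDerivAt_prodMk_left (𝕜 := ℝ) (chartOne E G) x
    rw [(HasFDerivAt.comp (f := fun y : E => (y, x)) (chartOne E G) hd.hasFDerivAt hp).fderiv]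
    rfl
  rw [← e]
  refine h.trans ?_
  exact mfderiv_chart_congr_base (one_mul g) _

theorem mfderiv_mul_right_Ad (g : G) (Y : GroupLieAlgebra 𝓘(ℝ, E) G) :
    (mfderiv 𝓘(ℝ, E) 𝓘(ℝ, E) (fun y : G => y * g) 1 (Ad (E := E) g Y) : E) =
      mulInvariantVectorField Y g := by
  have h := mfderiv_comp_apply_of_eq (1 : G) (mdifferentiable_mul_right (E := E) g 1)
    (mdifferentiable_conj (E := E) g 1) (by simp) Y
  have e : (fun y : G => y * g) ∘ (fun x : G => g * x * g⁻¹) = fun x => g * x := by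
    ext x; simp
  rw [e] at h
  exact h.symm

theorem Ad_mul (g h : G) (Y : GroupLieAlgebra 𝓘(ℝ, E) G) :
    Ad (E := E) (g * h) Y = Ad (E := E) g (Ad (E := E) h Y) := by
  have H := mfderiv_comp_apply_of_eq (1 : G) (mdifferentiable_conj (E := E) g 1)
    (mdifferentiable_conj (E := E) h 1) (by simp) Y
  have e : (fun x : G => g * x * g⁻¹) ∘ (fun x : G => h * x * h⁻¹) =
      fun x => g * h * x * (g * h)⁻¹ := by
    ext x; simp [mul_assoc]
  rw [e] at H
  exact H

theorem eventually_differentiableAt_chartMul :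
    ∀ᶠ p in 𝓝 (chartOne E G, chartOne E G), DifferentiableAt ℝ (chartMul E G) p := by
  have h := ((contDiffAt_chartMul (E := E) (G := G)).of_le (m := 1) (by simp)).eventually (by simp)
  filter_upwards [h] with p hp using hp.differentiableAt (by simp)

theorem differentiableAt_fderiv_chartMul :
    DifferentiableAt ℝ (fderiv ℝ (chartMul E G)) (chartOne E G, chartOne E G) :=
  ((contDiffAt_chartMul (E := E) (G := G)).fderiv_right (m := 1) (by norm_cast)).differentiableAt
    (by simp)

theorem fderiv_chartMul_chartOne_inr (X : E) :
    fderiv ℝ (chartMul E G) (chartOne E G, chartOne E G) ((0 : E), X) = X := by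
  refine (fderiv_chartMul_inr (x := chartOne E G) (mem_extChartAt_target (1 : G))
    eventually_differentiableAt_chartMul.self_of_nhds X).trans ?_
  refine (mfderiv_chart_congr_base chart_symm_chartOne _).trans ?_
  rw [mfderiv_extChartAt_self]
  exact (vectorField_congr_base chart_symm_chartOne).trans (mulInvariantVectorField_one X)

theorem fderiv_chartMul_chartOne_inl (X : E) :
    fderiv ℝ (chartMul E G) (chartOne E G, chartOne E G) (X, (0 : E)) = X := by
  refine (fderiv_chartMul_inl (x := chartOne E G) (mem_extChartAt_target (1 : G))
    eventually_differentiableAt_chartMul.self_of_nhds X).trans ?_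
  refine (mfderiv_chart_congr_base chart_symm_chartOne _).trans ?_
  rw [mfderiv_extChartAt_self, chart_symm_chartOne]
  have e : (fun x : G => x * 1) = id := by ext x; simp
  rw [e, mfderiv_id]
  rfl

/-- In the chart, a left-invariant field is the partial derivative of the product in the second
factor, so its derivative is a mixed second derivative. -/
theorem mpullbackWithin_mulInvariantVectorField_eventuallyEq (X : GroupLieAlgebra 𝓘(ℝ, E) G) :
    (VectorField.mpullbackWithin 𝓘(ℝ, E) 𝓘(ℝ, E) (extChartAt 𝓘(ℝ, E) (1 : G)).symm
      (mulInvariantVectorField X) (Set.range 𝓘(ℝ, E)) : E → E) =ᶠ[𝓝 (chartOne E G)]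
    fun x => fderiv ℝ (chartMul E G) (x, chartOne E G) ((0 : E), (X : E)) := by
  have hc : Filter.Tendsto (fun x : E => (x, chartOne E G)) (𝓝 (chartOne E G))
      (𝓝 (chartOne E G, chartOne E G)) :=
    (Continuous.prodMk_left (chartOne E G)).tendsto _
  filter_upwards [extChartAt_target_mem_nhds (I := 𝓘(ℝ, E)) (1 : G),
    hc.eventually eventually_differentiableAt_chartMul] with x hx hd
  rw [fderiv_chartMul_inr hx hd]
  have hi := isInvertible_mfderivWithin_extChartAt_symm (I := 𝓘(ℝ, E)) (x := (1 : G)) hx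
  have hc := mfderivWithin_extChartAt_symm_comp_mfderiv_extChartAt (I := 𝓘(ℝ, E))
    (x := (1 : G)) hx
  exact hi.inverse_apply_eq.mpr
    (DFunLike.congr_fun hc (mulInvariantVectorField X ((extChartAt 𝓘(ℝ, E) (1 : G)).symm x))).symm

theorem fderiv_fderiv_chartMul_inl_inr (X Y : E) :
    fderiv ℝ (fun x => fderiv ℝ (chartMul E G) (x, chartOne E G) ((0 : E), X))
      (chartOne E G) Y =
    fderiv ℝ (fderiv ℝ (chartMul E G)) (chartOne E G, chartOne E G) (Y, (0 : E))
        ((0 : E), X) := by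
  have hp := hasFDerivAt_prodMk_left (𝕜 := ℝ) (chartOne E G) (chartOne E G)
  have h1 := HasFDerivAt.comp (f := fun y : E => (y, chartOne E G)) (chartOne E G)
    (differentiableAt_fderiv_chartMul (E := E) (G := G)).hasFDerivAt hp
  have h2 := h1.clm_apply (hasFDerivAt_const ((0 : E), X) (chartOne E G))
  refine (DFunLike.congr_fun h2.fderiv Y).trans ?_
  simp

theorem lieBracket_eq_of_eventuallyEq {V W : E → E} {X Y : E}
    (hV : V =ᶠ[𝓝 (chartOne E G)] fun x => fderiv ℝ (chartMul E G) (x, chartOne E G) ((0 : E), X))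
    (hW : W =ᶠ[𝓝 (chartOne E G)]
      fun x => fderiv ℝ (chartMul E G) (x, chartOne E G) ((0 : E), Y)) :
    VectorField.lieBracketWithin ℝ V W Set.univ (chartOne E G) =
      fderiv ℝ (fderiv ℝ (chartMul E G)) (chartOne E G, chartOne E G) (X, (0 : E)) ((0 : E), Y) -
        fderiv ℝ (fderiv ℝ (chartMul E G)) (chartOne E G, chartOne E G) (Y, (0 : E))
          ((0 : E), X) := by
  rw [VectorField.lieBracketWithin_univ, hV.lieBracket_vectorField_eq hW, VectorField.lieBracket, fderiv_fderiv_chartMul_inl_inr,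
    fderiv_fderiv_chartMul_inl_inr, fderiv_chartMul_chartOne_inr, fderiv_chartMul_chartOne_inr]

/-- The Lie bracket in terms of the second derivative of the product in the chart at `1`. -/
theorem lie_eq_fderiv_fderiv_chartMul (X Y : GroupLieAlgebra 𝓘(ℝ, E) G) :
    ((⁅X, Y⁆ : GroupLieAlgebra 𝓘(ℝ, E) G) : E) =
      fderiv ℝ (fderiv ℝ (chartMul E G)) (chartOne E G, chartOne E G) ((X : E), (0 : E))
          ((0 : E), (Y : E)) -
        fderiv ℝ (fderiv ℝ (chartMul E G)) (chartOne E G, chartOne E G) ((Y : E), (0 : E))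
          ((0 : E), (X : E)) := by
  have h := lieBracket_eq_of_eventuallyEq (mpullbackWithin_mulInvariantVectorField_eventuallyEq X)
    (mpullbackWithin_mulInvariantVectorField_eventuallyEq Y)
  rw [GroupLieAlgebra.bracket_def, ← VectorField.mlieBracketWithin_univ,
    VectorField.mlieBracketWithin_apply, mfderiv_extChartAt_self]
  have hr : (extChartAt 𝓘(ℝ, E) (1 : G)).symm ⁻¹' Set.univ ∩ Set.range 𝓘(ℝ, E) = Set.univ := by
    simp
  rw [hr]
  refine Eq.trans ?_ h
  exact DFunLike.congr_fun (ContinuousLinearMap.inverse_id (R := ℝ) (M := E)) _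

end LieTriple

namespace LieTriple

variable {E : Type*} [NormedAddCommGroup E] [NormedSpace ℝ E]
  {G : Type*} [TopologicalSpace G] [ChartedSpace E G] [Group G]

/-- The adjoint action on the model space. -/
def modelAd (g : G) : E →L[ℝ] E := Ad (E := E) g

/-- The Lie bracket of `GroupLieAlgebra` on the model space. -/
def modelLie (E G : Type*) [NormedAddCommGroup E] [NormedSpace ℝ E] [TopologicalSpace G]
    [ChartedSpace E G] [Group G] (X Y : E) : E :=
  (⁅(show GroupLieAlgebra 𝓘(ℝ, E) G from X), (show GroupLieAlgebra 𝓘(ℝ, E) G from Y)⁆ :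
    GroupLieAlgebra 𝓘(ℝ, E) G)

variable [LieGroup 𝓘(ℝ, E) ∞ G]

/-! ### The derivative of the adjoint action along a one-parameter subgroup -/

section

variable {X : GroupLieAlgebra 𝓘(ℝ, E) G} {γ : ℝ → G}

theorem hasDerivAt_chart_comp_zero (h0 : γ 0 = 1)
    (hγ : IsMIntegralCurve (I := 𝓘(ℝ, E)) γ (mulInvariantVectorField X)) :
    HasDerivAt (fun t => extChartAt 𝓘(ℝ, E) (1 : G) (γ t)) (X : E) 0 := by
  have h := (hγ.isMIntegralCurveAt 0).eventually_hasDerivAt.self_of_nhds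
  replace h := h.congr_deriv (tangentCoordChange_self (mem_extChartAt_source _))
  rw [h0] at h
  exact h.congr_deriv (mulInvariantVectorField_one X)

/-- Right translation of `Ad(g) Y` equals left translation of `Y` at `g`, written in coordinates. It
defines `Ad` implicitly by derivatives of the product. -/
theorem eventually_fderiv_chartMul_Ad (h0 : γ 0 = 1)
    (hγ : IsMIntegralCurve (I := 𝓘(ℝ, E)) γ (mulInvariantVectorField X))
    (Y : GroupLieAlgebra 𝓘(ℝ, E) G) :
    ∀ᶠ t in 𝓝 (0 : ℝ),
      fderiv ℝ (chartMul E G) (chartOne E G, extChartAt 𝓘(ℝ, E) (1 : G) (γ t))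
        ((Ad (E := E) (γ t) Y : E), (0 : E)) =
      fderiv ℝ (chartMul E G) (extChartAt 𝓘(ℝ, E) (1 : G) (γ t), chartOne E G)
        ((0 : E), (Y : E)) := by
  have hc := (hasDerivAt_chart_comp_zero h0 hγ).continuousAt
  have he : extChartAt 𝓘(ℝ, E) (1 : G) (γ 0) = chartOne E G := by rw [h0]; rfl
  rw [ContinuousAt, he] at hc
  have h1 := (tendsto_const_nhds (x := chartOne E G)).prodMk_nhds hc
  have h2 := hc.prodMk_nhds (tendsto_const_nhds (x := chartOne E G))
  have hs : ∀ᶠ t in 𝓝 (0 : ℝ), γ t ∈ (extChartAt 𝓘(ℝ, E) (1 : G)).source := by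
    refine hγ.continuous.continuousAt.eventually ?_
    rw [h0]
    exact extChartAt_source_mem_nhds _
  filter_upwards [hs, h1.eventually eventually_differentiableAt_chartMul,
    h2.eventually eventually_differentiableAt_chartMul] with t hs hd1 hd2
  have ht := (extChartAt 𝓘(ℝ, E) (1 : G)).map_source hs
  have hinv := (extChartAt 𝓘(ℝ, E) (1 : G)).left_inv hs
  refine (fderiv_chartMul_inl ht hd1 (Ad (E := E) (γ t) Y)).trans ?_
  refine Eq.trans ?_ (fderiv_chartMul_inr ht hd2 Y).symm
  rw [hinv]
  exact congrArg _ (mfderiv_mul_right_Ad (γ t) Y)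

/-- Differentiating the implicit equation at `0` gives `D(X,0)(0,Y) - D(0,X)(Y,0)`, with `D` the
second derivative of the product. Symmetry of `D` turns this into the formula for the bracket. -/
theorem hasDerivAt_Ad_zero [CompleteSpace E] (h0 : γ 0 = 1)
    (hγ : IsMIntegralCurve (I := 𝓘(ℝ, E)) γ (mulInvariantVectorField X))
    (Y : E) :
    HasDerivAt (fun t => (modelAd (γ t) Y))
      (modelLie E G X Y) 0 := by
  have hx := hasDerivAt_chart_comp_zero h0 hγ
  have he : extChartAt 𝓘(ℝ, E) (1 : G) (γ 0) = chartOne E G := by rw [h0]; rfl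
  set x : ℝ → E := fun t => extChartAt 𝓘(ℝ, E) (1 : G) (γ t) with hxdef
  have hx0 : x 0 = chartOne E G := he
  set D := fderiv ℝ (fderiv ℝ (chartMul E G)) (chartOne E G, chartOne E G) with hD
  have hDf : HasFDerivAt (fderiv ℝ (chartMul E G)) D (chartOne E G, chartOne E G) :=
    (differentiableAt_fderiv_chartMul (E := E) (G := G)).hasFDerivAt
  have hsymm : IsSymmSndFDerivAt ℝ (chartMul E G) (chartOne E G, chartOne E G) :=
    (contDiffAt_chartMul (E := E) (G := G)).isSymmSndFDerivAt
      (by rw [minSmoothness_of_isRCLikeNormedField]; exact ENat.LEInfty.out)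
  have hA1 : HasDerivAt (fun t => fderiv ℝ (chartMul E G) (chartOne E G, x t))
      (D ((0 : E), (X : E))) 0 := by
    have h := (hasDerivAt_const (0 : ℝ) (chartOne E G)).prodMk hx
    exact HasFDerivAt.comp_hasDerivAt_of_eq (0 : ℝ) hDf h (by rw [hx0])
  have hF1 : HasDerivAt (fun t => fderiv ℝ (chartMul E G) (x t, chartOne E G))
      (D ((X : E), (0 : E))) 0 := by
    have h := hx.prodMk (hasDerivAt_const (0 : ℝ) (chartOne E G))
    exact HasFDerivAt.comp_hasDerivAt_of_eq (0 : ℝ) hDf h (by rw [hx0])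
  set A : ℝ → E →L[ℝ] E := fun t =>
    fderiv ℝ (chartMul E G) (chartOne E G, x t) ∘L ContinuousLinearMap.inl ℝ E E with hAdef
  have hA : HasDerivAt A (D ((0 : E), (X : E)) ∘L ContinuousLinearMap.inl ℝ E E) 0 := by
    have h := hA1.clm_comp (hasDerivAt_const (0 : ℝ) (ContinuousLinearMap.inl ℝ E E))
    simpa using h
  have hA0 : A 0 = 1 := by
    ext v
    simp only [hAdef, hx0]
    exact fderiv_chartMul_chartOne_inl v
  have hF : HasDerivAt (fun t => fderiv ℝ (chartMul E G) (x t, chartOne E G) ((0 : E), Y))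
      (D ((X : E), (0 : E)) ((0 : E), Y)) 0 := by
    have h := hF1.clm_apply (hasDerivAt_const (0 : ℝ) ((0 : E), Y))
    rw [map_zero, add_zero] at h
    exact h
  -- Differentiability of `Ad (γ t) Y` is not known beforehand; it follows by solving with the
  -- inverse of `A t`, a unit near `t = 0`.
  have hI : HasDerivAt (fun t => Ring.inverse (A t))
      (-(D ((0 : E), (X : E)) ∘L ContinuousLinearMap.inl ℝ E E)) 0 := by
    have h := hasFDerivAt_ringInverse (𝕜 := ℝ) (1 : (E →L[ℝ] E)ˣ)
    have h2 := HasFDerivAt.comp_hasDerivAt_of_eq (0 : ℝ) h hA (by simp [hA0])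
    refine h2.congr_deriv ?_
    ext v
    simp
  have hmain := hI.clm_apply hF
  have hunit : ∀ᶠ t in 𝓝 (0 : ℝ), IsUnit (A t) := by
    refine hA.continuousAt.eventually ?_
    rw [hA0]
    exact Units.nhds (1 : (E →L[ℝ] E)ˣ)
  refine (hmain.congr_of_eventuallyEq ?_).congr_deriv ?_
  · filter_upwards [hunit, eventually_fderiv_chartMul_Ad h0 hγ Y] with t ht1 ht2
    have h3 : A t (modelAd (γ t) Y) =
      fderiv ℝ (chartMul E G) (x t, chartOne E G) ((0 : E), Y) := ht2
    rw [← h3]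
    have h4 := DFunLike.congr_fun (Ring.inverse_mul_cancel (A t) ht1) (modelAd (γ t) Y)
    exact h4.symm
  · refine Eq.trans ?_ (lie_eq_fderiv_fderiv_chartMul X Y).symm
    have hs : D ((0 : E), (X : E)) ((Y : E), (0 : E)) = D ((Y : E), (0 : E)) ((0 : E), (X : E)) :=
      hsymm.eq _ _
    have hF0 : fderiv ℝ (chartMul E G) (x 0, chartOne E G) ((0 : E), Y) = (Y : E) := by
      rw [hx0]; exact fderiv_chartMul_chartOne_inr (Y : E)
    rw [hF0, hA0, Ring.inverse_one]
    change -(D ((0 : E), (X : E)) ((Y : E), (0 : E))) + D ((X : E), (0 : E)) ((0 : E), Y) = _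
    rw [hs, neg_add_eq_sub]

/-- The case `t = 0` is transported by `Ad (γ s) = Ad (γ t) Ad (γ (s - t))`. -/
theorem hasDerivAt_Ad [CompleteSpace E] [T2Space G] (h0 : γ 0 = 1)
    (hγ : IsMIntegralCurve (I := 𝓘(ℝ, E)) γ (mulInvariantVectorField X))
    (Y : E) (t : ℝ) :
    HasDerivAt (fun t => (modelAd (γ t) Y))
      (modelAd (γ t) (modelLie E G X Y)) t := by
  have h1 := hasDerivAt_Ad_zero h0 hγ Y
  have h2 : HasDerivAt (fun s => (modelAd (γ (s - t)) Y))
      (modelLie E G X Y) t := by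
    rw [← sub_self t] at h1
    exact h1.comp_sub_const t t
  have h3 := (modelAd (E := E) (γ t)).hasFDerivAt.comp_hasDerivAt t h2
  refine h3.congr_of_eventuallyEq (Filter.Eventually.of_forall fun s => ?_)
  have h4 : γ s = γ t * γ (s - t) := by
    rw [← IsMIntegralCurve.map_add h0 hγ]; simp
  change modelAd (γ s) Y = modelAd (γ t) (modelAd (γ (s - t)) Y)
  rw [h4]
  exact Ad_mul _ _ _

theorem modelAd_eq_self_of_modelLie_eq_zero [CompleteSpace E] [T2Space G] (h0 : γ 0 = 1)
    (hγ : IsMIntegralCurve (I := 𝓘(ℝ, E)) γ (mulInvariantVectorField X))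
    {Y : E} (hXY : modelLie E G X Y = 0) (t : ℝ) : modelAd (E := E) (γ t) Y = Y := by
  have hd : ∀ t, HasDerivAt (fun t => modelAd (E := E) (γ t) Y) (0 : E) t := fun t =>
    (hasDerivAt_Ad h0 hγ Y t).congr_deriv
      ((congrArg (modelAd (E := E) (γ t)) hXY).trans (map_zero (modelAd (E := E) (γ t))))
  have h1 := is_const_of_deriv_eq_zero (fun t => (hd t).differentiableAt) (fun t => (hd t).deriv) t 0
  refine Eq.trans h1 ?_
  simp only [h0]
  exact Ad_one Y

/-- If `ad X` acts on the plane spanned by `A` and `B` as an infinitesimal rotation, some element of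
the one-parameter subgroup of `X` acts there as `-1`. -/
theorem exists_modelAd_eq_neg [CompleteSpace E] [T2Space G] (h0 : γ 0 = 1)
    (hγ : IsMIntegralCurve (I := 𝓘(ℝ, E)) γ (mulInvariantVectorField X))
    {A B : E} {p : ℝ} (hp : 0 < p) (hA : modelLie E G X A = p • B)
    (hB : modelLie E G X B = -A) : ∃ t, modelAd (E := E) (γ t) A = -A := by
  set r := Real.sqrt p with hr
  have hr0 : 0 < r := Real.sqrt_pos.mpr hp
  have hrr : r * r = p := Real.mul_self_sqrt hp.le
  -- The rotation in the plane of `A` and `B` is undone inside `Ad (γ t)`, so `f` is constant; at `π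
  -- / r` it is `-Ad (γ t) A`, at `0` it is `A`.
  obtain ⟨f, hf⟩ : ∃ f : ℝ → E, f = fun t => Real.cos (r * t) • modelAd (E := E) (γ t) A -
    (r * Real.sin (r * t)) • modelAd (E := E) (γ t) B := ⟨_, rfl⟩
  have hd : ∀ t, HasDerivAt f 0 t := fun t => by
    have hl : HasDerivAt (fun t => r * t) r t := by simpa using (hasDerivAt_id t).const_mul r
    have h1 := hl.cos.smul ((hasDerivAt_Ad h0 hγ A t).congr_deriv
      ((congrArg (modelAd (E := E) (γ t)) hA).trans (map_smul (modelAd (E := E) (γ t)) p B)))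
    have h2 := (hl.sin.const_mul r).smul ((hasDerivAt_Ad h0 hγ B t).congr_deriv
      ((congrArg (modelAd (E := E) (γ t)) hB).trans (map_neg (modelAd (E := E) (γ t)) A)))
    rw [hf]
    refine (h1.sub h2).congr_deriv ?_
    rw [← hrr]
    module
  have h1 := is_const_of_deriv_eq_zero (fun t => (hd t).differentiableAt) (fun t => (hd t).deriv)
    (Real.pi / r) 0
  refine ⟨Real.pi / r, ?_⟩
  have h2 : r * (Real.pi / r) = Real.pi := by field_simp
  simp only [hf, h2, mul_zero, Real.cos_pi, Real.sin_pi, Real.cos_zero, Real.sin_zero, h0,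
    zero_smul, sub_zero, one_smul, neg_smul] at h1
  have h3 : modelAd (E := E) (1 : G) A = A := Ad_one A
  rw [h3] at h1
  exact neg_eq_iff_eq_neg.mp h1

end

end LieTriple

/-! ### Weyl group elements as adjoint actions. -/

namespace LieTriple

variable {E : Type*} [NormedAddCommGroup E] [NormedSpace ℝ E] [FiniteDimensional ℝ E]
  [CompleteSpace E] {G : Type*} [TopologicalSpace G] [T2Space G] [ChartedSpace E G] [Group G]
  [LieGroup 𝓘(ℝ, E) ∞ G]

instance finiteDimensional_groupLieAlgebra :
    FiniteDimensional ℝ (GroupLieAlgebra 𝓘(ℝ, E) G) :=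
  inferInstanceAs (FiniteDimensional ℝ E)

/-- The reflection in a root is the adjoint action of an element of the subgroup
generated by `Exp [m, m]`. -/
theorem exists_Ad_eq_reflection (hcompact : KillingNegDef (GroupLieAlgebra 𝓘(ℝ, E) G))
    {c : ℝ} (hc : 0 < c) {m a : Submodule ℝ (GroupLieAlgebra 𝓘(ℝ, E) G)}
    (hm : IsLieTripleSystem m) (ha : IsCartan m a) {α : Module.Dual ℝ a} (hα : α ∈ roots m a)
    {R : a ≃ₗ[ℝ] a} (hR : IsOrthogonalReflection c a α R) :
    ∃ g ∈ connectedLieSubgroup (derived m), ∀ Z : a,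
      (R Z : GroupLieAlgebra 𝓘(ℝ, E) G) = Ad (E := E) g (Z : GroupLieAlgebra 𝓘(ℝ, E) G) := by
  obtain ⟨A, X, Y, h⟩ := exists_rootTriple hcompact hc hm ha hα
  obtain ⟨γ, h0, hγ⟩ := exists_isMIntegralCurve_one (E := E) Y
  obtain ⟨t, ht⟩ := exists_modelAd_eq_neg h0 hγ (A := (A : GroupLieAlgebra 𝓘(ℝ, E) G)) (B := X)
    h.pos (h.lie_swap A) h.lie_eq'
  have hA : Ad (E := E) (γ t) (A : GroupLieAlgebra 𝓘(ℝ, E) G) =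
    -(A : GroupLieAlgebra 𝓘(ℝ, E) G) := ht
  refine ⟨γ t, Subgroup.subset_closure ⟨t • Y, (derived m).smul_mem t h.mem_derived,
    isExp_smul h0 hγ t⟩, fun Z => ?_⟩
  have hfix : ∀ Z : a, α Z = 0 → Ad (E := E) (γ t) (Z : GroupLieAlgebra 𝓘(ℝ, E) G) =
      (Z : GroupLieAlgebra 𝓘(ℝ, E) G) := fun Z hZ => by
    have hl : ⁅Y, (Z : GroupLieAlgebra 𝓘(ℝ, E) G)⁆ = 0 := by rw [h.lie_swap, hZ, zero_smul]
    exact modelAd_eq_self_of_modelLie_eq_zero h0 hγ hl t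
  have hZ : (Z : GroupLieAlgebra 𝓘(ℝ, E) G) = (α Z / α A) • (A : GroupLieAlgebra 𝓘(ℝ, E) G) +
      ((Z - (α Z / α A) • A : a) : GroupLieAlgebra 𝓘(ℝ, E) G) := by
    simp
  rw [hR.apply h]
  conv_rhs => rw [hZ]
  rw [map_add, map_smul, hA, hfix _ (h.apply_sub Z)]
  simp

theorem exists_Ad_eq_of_mem_weylGroup (hcompact : KillingNegDef (GroupLieAlgebra 𝓘(ℝ, E) G))
    {c : ℝ} (hc : 0 < c) {m a : Submodule ℝ (GroupLieAlgebra 𝓘(ℝ, E) G)}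
    (hm : IsLieTripleSystem m) (ha : IsCartan m a) {w : a ≃ₗ[ℝ] a} (hw : w ∈ weylGroup c m a) :
    ∃ g ∈ connectedLieSubgroup (derived m), ∀ Z : a,
      (w Z : GroupLieAlgebra 𝓘(ℝ, E) G) = Ad (E := E) g (Z : GroupLieAlgebra 𝓘(ℝ, E) G) := by
  induction hw using Subgroup.closure_induction with
  | mem R hR =>
    obtain ⟨α, hα, hR⟩ := hR
    exact exists_Ad_eq_reflection hcompact hc hm ha hα hR
  | one => exact ⟨1, one_mem _, fun Z => (Ad_one _).symm⟩
  | mul v w _ _ hv hw =>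
    obtain ⟨g, hg, hgv⟩ := hv
    obtain ⟨h, hh, hhw⟩ := hw
    refine ⟨g * h, mul_mem hg hh, fun Z => ?_⟩
    rw [Ad_mul, ← hhw, ← hgv, LinearEquiv.mul_apply]
  | inv w _ hw =>
    obtain ⟨g, hg, hgw⟩ := hw
    refine ⟨g⁻¹, inv_mem hg, fun Z => ?_⟩
    have h1 : (Z : GroupLieAlgebra 𝓘(ℝ, E) G) = Ad (E := E) g (w⁻¹ Z : a) := by
      
      rw [← hgw]
      exact congrArg Subtype.val (w.apply_symm_apply Z).symm
    conv_rhs => rw [h1]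
    rw [← Ad_mul, inv_mul_cancel, Ad_one]

end LieTriple

end

/-! ### The main theorem. -/

theorem proposition2p6
    {E : Type*} [NormedAddCommGroup E] [NormedSpace ℝ E] [FiniteDimensional ℝ E] [CompleteSpace E]
    {G : Type*} [TopologicalSpace G] [T2Space G] [ChartedSpace E G] [Group G]
    [LieGroup 𝓘(ℝ, E) ∞ G]
    (σ : G →* G) (K : Subgroup G) (hσK : LieTriple.IsSymmetricPair E σ K)
    (hcompact : LieTriple.KillingNegDef (GroupLieAlgebra 𝓘(ℝ, E) G))
    (c : ℝ) (hc : 0 < c)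
    (m m' a a' : Submodule ℝ (GroupLieAlgebra 𝓘(ℝ, E) G))
    (hm : m = LieTriple.tangentPart E σ)
    (hm'm : m' ≤ m) (hm' : LieTriple.IsLieTripleSystem m')
    (ha : LieTriple.IsCartan m a)
    (haa' : a' = a ⊓ m') (ha' : LieTriple.IsCartan m' a') :
    (∃ P : a →ₗ[ℝ] a, LieTriple.IsOrthogonalProjection c a a' P ∧
      ∀ B' ∈ LieTriple.weylGroup c m' a', ∃ B ∈ LieTriple.weylGroup c m a,
        ∀ (Z : GroupLieAlgebra 𝓘(ℝ, E) G) (hZa' : Z ∈ a') (hZa : Z ∈ a),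
          (B' ⟨Z, hZa'⟩ : GroupLieAlgebra 𝓘(ℝ, E) G) = P (B ⟨Z, hZa⟩)) ∧
    (LieTriple.rank m' = LieTriple.rank m →
      a' = a ∧ LieTriple.weylGroup c m' a ≤ LieTriple.weylGroup c m a) ∧
    LieTriple.connectedLieSubgroup (LieTriple.derived m') ≤ K ∧
    (∀ B' ∈ LieTriple.weylGroup c m' a',
      ∃ g ∈ LieTriple.connectedLieSubgroup (LieTriple.derived m'),
        ∀ Z : a', (B' Z : GroupLieAlgebra 𝓘(ℝ, E) G) =
          LieTriple.Ad (E := E) g (Z : GroupLieAlgebra 𝓘(ℝ, E) G)) ∧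
    (∀ B' ∈ LieTriple.weylGroup c m' a',
      (fun β : Module.Dual ℝ a' => β ∘ₗ ((B'⁻¹ : a' ≃ₗ[ℝ] a') : a' →ₗ[ℝ] a')) ''
        LieTriple.roots m' a' = LieTriple.roots m' a') := by
  let θ := LieTriple.derivEquiv hσK.smooth hσK.involutive
  have hθ : ∀ X, θ (θ X) = X := LieTriple.derivOne_derivOne hσK.smooth hσK.involutive
  have hmθ : ∀ X, X ∈ m ↔ θ X = -X := fun X => by
    rw [hm, LieTriple.tangentPart, LinearMap.mem_ker]
    exact add_eq_zero_iff_eq_neg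
  have hle : a' ≤ a := haa' ▸ inf_le_left
  obtain ⟨P, hP, hPa'⟩ := LieTriple.exists_isOrthogonalProjection hcompact hc hle
  refine ⟨⟨P, hP, fun B' hB' => ?_⟩, fun hrank => ?_, ?_, fun B' hB' =>
    LieTriple.exists_Ad_eq_of_mem_weylGroup hcompact hc hm' ha' hB', fun B' hB' =>
    LieTriple.image_roots_eq hcompact hc hm' ha' hB'⟩
  · obtain ⟨B, hB, hBB'⟩ := LieTriple.exists_weylGroup_extension hcompact hc hθ hmθ hm'm hm' ha ha'
      hle hB'
    refine ⟨B, hB, fun Z hZa' hZa => ?_⟩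
    have h : (B ⟨Z, hZa⟩ : GroupLieAlgebra 𝓘(ℝ, E) G) = B' ⟨Z, hZa'⟩ := hBB' ⟨Z, hZa'⟩
    -- `B Z` already lies in `a'`, so the projection fixes it.
    rw [hPa' _ (h ▸ (B' ⟨Z, hZa'⟩).2), h]
  · obtain rfl : a' = a := Submodule.eq_of_le_of_finrank_eq hle (by rw [ha'.2.2, ha.2.2, hrank])
    refine ⟨rfl, fun B' hB' => ?_⟩
    obtain ⟨B, hB, hBB'⟩ := LieTriple.exists_weylGroup_extension hcompact hc hθ hmθ hm'm hm' ha ha'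
      le_rfl hB'
    obtain rfl : B = B' := LinearEquiv.ext fun Z => Subtype.ext (hBB' Z)
    exact hB
  · refine (Subgroup.closure_le K).mpr ?_
    rintro g ⟨X, hX, hg⟩
    exact LieTriple.mem_of_isExp hσK
      (LieTriple.fixed_of_mem_derived (θ := θ) (fun Y hY => (hmθ Y).mp (hm'm hY)) hX) hg
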